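/- Graphs are finite and loopless; multiple edges are allowed. Write $\omega(G)$ for the number of components of $G$ and $d_G(v)$ for the degree of $v$. Let $m\ge 1$ be an integer. A graph is $m$-tree-connected if it has $m$ pairwise edge-disjoint spanning trees; the $m$-tree-connected components of a graph are its maximal induced $m$-tree-connected subgraphs. For a subgraph $C$ of a graph $F$, let $d_F(C)$ be the number of edges of $F$ with exactly one end in $V(C)$. Let $G$ be a graph with a spanning subgraph $F$, and let $c\ge 2m+1$ be a real number. Suppose that every $m$-tree-connected component $C$ of $F$ satisfies $$|V(C)|\ \ge\ c-\frac{c-1}{2m}\,d_F(C),$$ and that for every $S\subseteq V(G)$, $$\omega(G\setminus S)\ \le\ \frac{c-2m}{2m(c-1)}\,|S|+1 .$$ Then for every vertex $u$ of $G$ there is an $m$-tree-connected spanning subgraph $H$ of $G$ containing $F$ such that $d_H(v)\le d_F(v)+1$ for every vertex $v$ and $d_H(u)=d_F(u)$. -/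

import Mathlib

open scoped Graph

namespace Graph

variable {α β : Type*}

/-- The degree of a vertex: the number of edges incident to it. It is only used for loopless
graphs, where every incident edge counts once. -/
noncomputable def degree (G : Graph α β) (v : α) : ℕ := (G.incidenceSet v).ncard

/-- The number of edges with exactly one end in the vertex set `X`. -/
noncomputable def boundaryDegree (G : Graph α β) (X : Set α) : ℕ :=
  {e | ∃ x ∈ X, ∃ y ∉ X, G.IsLink e x y}.ncard

/-- The number of connected components (it is `0` for the graph without vertices). -/
noncomputable def numComponents (G : Graph α β) : ℕ := Nat.card G.toSimpleGraph.ConnectedComponent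

/-- A (multi)graph is a tree if it has no loops or parallel edges and, as a simple graph, it is
connected (in particular, nonempty) and acyclic. -/
def IsTree (T : Graph α β) : Prop := T.Simple ∧ T.toSimpleGraph.IsTree

/-- `G` is `m`-tree-connected if it has `m` pairwise edge-disjoint spanning trees. -/
def IsTreeConnected (G : Graph α β) (m : ℕ) : Prop :=
  ∃ T : Fin m → Graph α β,
    (∀ i, T i ≤s G ∧ (T i).IsTree) ∧ Pairwise fun i j => Disjoint E(T i) E(T j)

/-- `X` is the vertex set of an `m`-tree-connected component of `G`, i.e. of a maximal induced
`m`-tree-connected subgraph `G[X]`. -/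
def IsTreeComponent (G : Graph α β) (m : ℕ) (X : Set α) : Prop :=
  Maximal (fun Y : Set α => Y ⊆ V(G) ∧ (G.induce Y).IsTreeConnected m) X

end Graph

set_option linter.unusedSectionVars false

/-! ### Sparse edge sets, tight sets and exchange -/

namespace EdgeSparse

open Finset

variable {α β : Type*} [DecidableEq α] [DecidableEq β]

/-! Sparse edge sets are the disjoint unions of `m` forests (`Sparse.exists_forests`), so a sparse
set for which the whole vertex set `V` is tight yields `m` disjoint spanning trees. Take a maximum
sparse subset `B₀` of `F`. It suffices to find a matching `M` of edges outside `F` that misses `u`,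
such that `B₀ ∪ M` is sparse with `m (|V| - 1)` edges: then `H = F + M` works. This is
`exists_matching_basis`.

Let `M` be a largest matching that misses `u` and keeps `B₀ ∪ M` sparse. An alternating exchange
argument (`Feasible.exists_freeable`) gives a set `W` avoiding `u` such that `M` covers `S = V \ W`
except for `u`, and every edge outside `F` within `W` is spanned by `A = B₀ ∪ M[W]`. Partition `V`
into the maximal tight sets of `A`. An edge of `G` inside `W` that joins two members must lie in
`B₀`. So if `K ⊆ W` contains no such edge, each component of `G[K]` lies in one member, and
toughness with the cut `V \ K` bounds the number of members that `K` meets.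

The maximal tight sets of `B₀` are the tree components of `F` (`isTreeComponent_of_maximal`), and
their lower bound on order passes to the larger members of the partition (`le_card_of_tight`). If
`d(C)` counts the crossing edges at a member `C`, then the sum of `1 - d(C) / (2m)` over the
partition measures how far `A` is from spanning. A well-chosen `K` bounds this sum (`sum_weight_le`,
`weight_le`), and counting the ends of `M` in `S` shows that a deficient `B₀ ∪ M` would exceed the
bound. -/

/-- The edges of `B` with both ends in `X`, where `e` has the ends `p e` and `q e`. -/
def inside (p q : β → α) (B : Finset β) (X : Finset α) : Finset β :=
  B.filter fun e => p e ∈ X ∧ q e ∈ X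

/-- `B` is `(k, k)`-sparse: a nonempty vertex set `X` spans at most `k (|X| - 1)` of its edges. -/
def Sparse (p q : β → α) (k : ℕ) (B : Finset β) : Prop :=
  ∀ X : Finset α, X.Nonempty → #(inside p q B X) + k ≤ k * #X

/-- `X` spans exactly `k (|X| - 1)` edges of `B`. -/
def Tight (p q : β → α) (k : ℕ) (B : Finset β) (X : Finset α) : Prop :=
  X.Nonempty ∧ #(inside p q B X) + k = k * #X

/-- `T` is the least tight set of `B` that contains both ends of `e`. -/
def IsSpan (p q : β → α) (k : ℕ) (B : Finset β) (e : β) (T : Finset α) : Prop :=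
  Tight p q k B T ∧ p e ∈ T ∧ q e ∈ T ∧
    ∀ Z, Tight p q k B Z → p e ∈ Z → q e ∈ Z → T ⊆ Z

variable {p q : β → α} {k : ℕ} {B : Finset β} {X Y Z T : Finset α} {e f : β}

lemma mem_inside : e ∈ inside p q B X ↔ e ∈ B ∧ p e ∈ X ∧ q e ∈ X := by
  simp [inside]

lemma inside_subset : inside p q B X ⊆ B := filter_subset _ _

lemma inside_mono {B' : Finset β} (hB : B ⊆ B') (hX : X ⊆ Y) :
    inside p q B X ⊆ inside p q B' Y := fun e he => by
  rw [mem_inside] at he ⊢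
  exact ⟨hB he.1, hX he.2.1, hX he.2.2⟩

lemma Sparse.mono {B' : Finset β} (hB : Sparse p q k B) (h : B' ⊆ B) : Sparse p q k B' :=
  fun X hX => (Nat.add_le_add_right (card_le_card (inside_mono h Subset.rfl)) k).trans (hB X hX)

lemma sparse_empty : Sparse p q k (∅ : Finset β) := fun X hX => by
  have : 1 ≤ #X := hX.card_pos
  simp only [inside, filter_empty, card_empty]
  nlinarith

lemma inside_union_subset :
    inside p q B X ∪ inside p q B Y ⊆ inside p q B (X ∪ Y) :=
  union_subset (inside_mono Subset.rfl subset_union_left)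
    (inside_mono Subset.rfl subset_union_right)

lemma inside_inter : inside p q B X ∩ inside p q B Y = inside p q B (X ∩ Y) := by
  ext e
  simp only [mem_inter, mem_inside]
  tauto

lemma card_inside_add_le :
    #(inside p q B X) + #(inside p q B Y) ≤
      #(inside p q B (X ∪ Y)) + #(inside p q B (X ∩ Y)) := by
  rw [← card_union_add_card_inter, inside_inter]
  exact Nat.add_le_add_right (card_le_card inside_union_subset) _

/-- The number of spanned edges is supermodular and `k |X|` is modular. As `X` and `Y` attain the
sparsity bound, so must their union and intersection, and no edge is left to join `X \ Y` to `Y \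
X`. -/
lemma Tight.union_inter (hB : Sparse p q k B) (hX : Tight p q k B X) (hY : Tight p q k B Y)
    (hXY : (X ∩ Y).Nonempty) : Tight p q k B (X ∪ Y) ∧ Tight p q k B (X ∩ Y) ∧
      inside p q B (X ∪ Y) = inside p q B X ∪ inside p q B Y := by
  have h1 := hB (X ∪ Y) (hX.1.mono subset_union_left)
  have h2 := hB _ hXY
  have h3 := card_inside_add_le (p := p) (q := q) (B := B) (X := X) (Y := Y)
  have h4 := card_union_add_card_inter X Y
  have h5 := hX.2
  have h6 := hY.2
  have h7 : k * #(X ∪ Y) + k * #(X ∩ Y) = k * #X + k * #Y := by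
    rw [← mul_add, ← mul_add, h4]
  have h8 := card_union_add_card_inter (inside p q B X) (inside p q B Y)
  rw [inside_inter] at h8
  refine ⟨⟨hX.1.mono subset_union_left, by omega⟩, ⟨hXY, by omega⟩, ?_⟩
  refine (eq_of_subset_of_card_le inside_union_subset ?_).symm
  omega

lemma Tight.union (hB : Sparse p q k B) (hX : Tight p q k B X) (hY : Tight p q k B Y)
    (hXY : (X ∩ Y).Nonempty) : Tight p q k B (X ∪ Y) :=
  (hX.union_inter hB hY hXY).1

lemma Tight.inter (hB : Sparse p q k B) (hX : Tight p q k B X) (hY : Tight p q k B Y)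
    (hXY : (X ∩ Y).Nonempty) : Tight p q k B (X ∩ Y) :=
  (hX.union_inter hB hY hXY).2.1

lemma Sparse.ne (hB : Sparse p q k B) (he : e ∈ B) : p e ≠ q e := fun h => by
  have h1 := hB {p e} (singleton_nonempty _)
  have h2 : e ∈ inside p q B {p e} := by simp [mem_inside, he, h]
  have := card_pos.2 ⟨e, h2⟩
  simp at h1
  simp [h1] at h2

lemma Sparse.tight_singleton (hB : Sparse p q k B) (v : α) : Tight p q k B {v} :=
  ⟨singleton_nonempty _, by have := hB {v} (singleton_nonempty _); simp at this; simp [this]⟩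

/-- A tight set of a subset of a sparse set spans no further edges. -/
lemma Tight.inside_eq {B' : Finset β} (hX : Tight p q k B X) (h : B ⊆ B')
    (hB' : Sparse p q k B') : inside p q B' X = inside p q B X := by
  refine (eq_of_subset_of_card_le (inside_mono h Subset.rfl) ?_).symm
  have := hB' X hX.1
  have := hX.2
  omega

lemma Tight.mono {B' : Finset β} (hX : Tight p q k B X) (h : B ⊆ B')
    (hB' : Sparse p q k B') : Tight p q k B' X :=
  ⟨hX.1, by rw [hX.inside_eq h hB', hX.2]⟩

lemma inside_insert (he : p e ∈ X ∧ q e ∈ X) :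
    inside p q (insert e B) X = insert e (inside p q B X) := by
  rw [inside, filter_insert, if_pos he, inside]

lemma inside_insert_of_not (he : ¬ (p e ∈ X ∧ q e ∈ X)) :
    inside p q (insert e B) X = inside p q B X := by
  rw [inside, filter_insert, if_neg he, inside]

/-- An edge that cannot be added to a sparse set has a span. -/
lemma exists_isSpan (hB : Sparse p q k B) (he : ¬ Sparse p q k (insert e B)) :
    ∃ T, IsSpan p q k B e T := by
  have hex : ∃ T, Tight p q k B T ∧ p e ∈ T ∧ q e ∈ T := by
    simp only [Sparse, not_forall] at he
    obtain ⟨X, hX, hlt⟩ := he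
    have h1 := hB X hX
    by_cases hin : p e ∈ X ∧ q e ∈ X
    · rw [inside_insert hin] at hlt
      have := card_insert_le e (inside p q B X)
      exact ⟨X, ⟨hX, by omega⟩, hin⟩
    · rw [inside_insert_of_not hin] at hlt
      omega
  obtain ⟨T, hT, hmin⟩ := exists_minimalFor_of_wellFoundedLT
    (fun T => Tight p q k B T ∧ p e ∈ T ∧ q e ∈ T) (fun T : Finset α => #T) hex
  refine ⟨T, hT.1, hT.2.1, hT.2.2, fun Z hZ hp hq => ?_⟩
  have hne : (T ∩ Z).Nonempty := ⟨p e, by simp [hp, hT.2.1]⟩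
  have h := hmin ⟨hT.1.inter hB hZ hne, by simp [hp, hT.2.1], by simp [hq, hT.2.2]⟩
    (card_le_card inter_subset_left)
  have := eq_of_subset_of_card_le (inter_subset_left (s₁ := T) (s₂ := Z)) h
  exact inter_eq_left.1 this

lemma card_inside_exchange (hf : f ∈ inside p q B X) (he : e ∉ B) (hp : p e ∈ X)
    (hq : q e ∈ X) : #(inside p q (insert e (B.erase f)) X) = #(inside p q B X) := by
  rw [inside_insert ⟨hp, hq⟩, card_insert_of_notMem (by simp [mem_inside, he])]
  have : inside p q (B.erase f) X = (inside p q B X).erase f := by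
    ext g; simp only [mem_inside, mem_erase]; tauto
  rw [this, card_erase_add_one hf]

/-- Adding `e` can overfill only a tight set containing both its ends. Such a set contains the span
`T` by minimality, so it loses `f` in return. -/
lemma IsSpan.exchange (hT : IsSpan p q k B e T) (hB : Sparse p q k B) (he : e ∉ B)
    (hf : f ∈ inside p q B T) : Sparse p q k (insert e (B.erase f)) := by
  intro X hX
  have h1 := hB X hX
  have h3 : #(inside p q (B.erase f) X) ≤ #(inside p q B X) :=
    card_le_card (inside_mono (erase_subset _ _) Subset.rfl)
  by_cases hin : p e ∈ X ∧ q e ∈ X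
  · by_cases ht : Tight p q k B X
    · have hTX := hT.2.2.2 X ht hin.1 hin.2
      rw [card_inside_exchange (inside_mono Subset.rfl hTX hf) he hin.1 hin.2]
      exact h1
    · have h2 : #(inside p q B X) + k ≠ k * #X := fun h => ht ⟨hX, h⟩
      rw [inside_insert hin]
      have := card_insert_le e (inside p q (B.erase f) X)
      omega
  · rw [inside_insert_of_not hin]
    omega

/-- The edges of `B` spanned by a tight set connect it. -/
lemma Tight.exists_crossing (hk : 1 ≤ k) (hB : Sparse p q k B) (hT : Tight p q k B T)
    (hA : (T ∩ X).Nonempty) (hA' : ¬ T ⊆ X) :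
    ∃ f ∈ inside p q B T, (p f ∈ X ∧ q f ∉ X) ∨ (p f ∉ X ∧ q f ∈ X) := by
  by_contra! hcon
  have hsub : inside p q B T ⊆ inside p q B (T ∩ X) ∪ inside p q B (T \ X) := by
    intro f hf
    have := hcon f hf
    simp only [mem_union, mem_inside, mem_inter, mem_sdiff] at hf ⊢
    tauto
  have h1 := hB _ hA
  have h2 := hB (T \ X) (by rwa [sdiff_nonempty])
  have h3 := hT.2
  have h4 := (card_le_card hsub).trans (card_union_le _ _)
  have h5 : k * #(T ∩ X) + k * #(T \ X) = k * #T := by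
    rw [← mul_add, add_comm, card_sdiff_add_card_inter]
  omega

/-- Replacing the edges inside a tight set by another sparse set of edges inside it. -/
lemma Sparse.replace (hB : Sparse p q k B) (hX : Tight p q k B X) {D : Finset β}
    (hD : Sparse p q k D) (hDX : ∀ e ∈ D, p e ∈ X ∧ q e ∈ X) :
    Sparse p q k (B \ inside p q B X ∪ D) := by
  intro Z hZ
  have h1 : inside p q (B \ inside p q B X ∪ D) Z ⊆
      (inside p q B Z \ inside p q B (Z ∩ X)) ∪ inside p q D (Z ∩ X) := by
    intro e he
    simp only [mem_union, mem_inside, mem_inter, mem_sdiff] at he ⊢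
    have := hDX e
    tauto
  have h2 := (card_le_card h1).trans (card_union_le _ _)
  have h3 : #(inside p q B Z \ inside p q B (Z ∩ X)) + #(inside p q B (Z ∩ X)) =
      #(inside p q B Z) :=
    card_sdiff_add_card_eq_card (inside_mono Subset.rfl inter_subset_left)
  rcases (Z ∩ X).eq_empty_or_nonempty with h0 | h0
  · have h4 : #(inside p q D (Z ∩ X)) = 0 := by simp [h0, inside]
    have := hB Z hZ
    omega
  · have h4 := hD _ h0
    -- Supermodularity with the tight set `X` bounds the edges of `B` in `Z` that are not in `Z ∩ X`
    -- by `k (|Z| - |Z ∩ X|)`, which leaves room for `D`.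
    have h5 := card_inside_add_le (p := p) (q := q) (B := B) (X := Z) (Y := X)
    have h6 := hB (Z ∪ X) (hZ.mono subset_union_left)
    have h7 := hX.2
    have h8 : k * #(Z ∪ X) + k * #(Z ∩ X) = k * #Z + k * #X := by
      rw [← mul_add, ← mul_add, card_union_add_card_inter]
    omega

end EdgeSparse

/-! ### Decomposition into forests (matroid union for sparse sets) -/

namespace EdgeSparse

open Finset

variable {α β : Type*} [DecidableEq α] [DecidableEq β]
variable {p q : β → α}

/-- `Reach p q a b I₀ J₀ e₀ I J e`: the triple `(I, J, e)` arises from `(I₀, J₀, e₀)` by repeatedly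
putting the left-over edge into one of the two classes, in exchange for an edge of its span. -/
inductive Reach (p q : β → α) (a b : ℕ) (I₀ J₀ : Finset β) (e₀ : β) :
    Finset β → Finset β → β → Prop
  | refl : Reach p q a b I₀ J₀ e₀ I₀ J₀ e₀
  | left {I J e T f} : Reach p q a b I₀ J₀ e₀ I J e → IsSpan p q a I e T → f ∈ inside p q I T →
      Reach p q a b I₀ J₀ e₀ (insert e (I.erase f)) J f
  | right {I J e T f} : Reach p q a b I₀ J₀ e₀ I J e → IsSpan p q b J e T → f ∈ inside p q J T →
      Reach p q a b I₀ J₀ e₀ I (insert e (J.erase f)) f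

variable {a b : ℕ} {I₀ J₀ I J B : Finset β} {e₀ e : β}

lemma Reach.swap (h : Reach p q a b I₀ J₀ e₀ I J e) : Reach p q b a J₀ I₀ e₀ J I e := by
  induction h with
  | refl => exact .refl
  | left _ hT hf ih => exact .right ih hT hf
  | right _ hT hf ih => exact .left ih hT hf

/-- `(I, J, e)` is a partition of `B` into an `a`-sparse set, a `b`-sparse set and one edge. -/
def SplitsUpTo (p q : β → α) (a b : ℕ) (B I J : Finset β) (e : β) : Prop :=
  Sparse p q a I ∧ Sparse p q b J ∧ Disjoint I J ∧ e ∉ I ∧ e ∉ J ∧ insert e (I ∪ J) = B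

lemma SplitsUpTo.swap (h : SplitsUpTo p q a b B I J e) : SplitsUpTo p q b a B J I e :=
  ⟨h.2.1, h.1, h.2.2.1.symm, h.2.2.2.2.1, h.2.2.2.1, by rw [union_comm]; exact h.2.2.2.2.2⟩

lemma SplitsUpTo.left {T : Finset α} {f : β} (h : SplitsUpTo p q a b B I J e)
    (hT : IsSpan p q a I e T) (hf : f ∈ inside p q I T) :
    SplitsUpTo p q a b B (insert e (I.erase f)) J f := by
  obtain ⟨hI, hJ, hd, heI, heJ, hB⟩ := h
  have hfI := (mem_inside.1 hf).1
  have hfJ : f ∉ J := disjoint_left.1 hd hfI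
  have hef : f ≠ e := fun h => heI (h ▸ hfI)
  refine ⟨hT.exchange hI heI hf, hJ, ?_, by simp [hef], hfJ, ?_⟩
  · rw [disjoint_insert_left]
    exact ⟨heJ, hd.mono_left (erase_subset _ _)⟩
  · rw [← hB]
    ext x
    simp only [mem_insert, mem_union, mem_erase]
    by_cases hx : x = f
    · subst hx; simp [hfI]
    · simp [hx, or_assoc]

lemma Reach.splitsUpTo (h : Reach p q a b I₀ J₀ e₀ I J e)
    (h₀ : SplitsUpTo p q a b B I₀ J₀ e₀) : SplitsUpTo p q a b B I J e := by
  induction h with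
  | refl => exact h₀
  | left _ hT hf ih => exact ih.left hT hf
  | right _ hT hf ih => exact (ih.swap.left hT hf).swap

lemma SplitsUpTo.exists_isSpan (h : SplitsUpTo p q a b B I J e)
    (hno : ¬ ∃ I J, Disjoint I J ∧ I ∪ J = B ∧ Sparse p q a I ∧ Sparse p q b J) :
    ∃ T, IsSpan p q a I e T := by
  obtain ⟨hI, hJ, hd, heI, heJ, hB⟩ := h
  refine EdgeSparse.exists_isSpan hI fun hs => hno ⟨insert e I, J, ?_, ?_, hs, hJ⟩
  · rw [disjoint_insert_left]; exact ⟨heJ, hd⟩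
  · rw [insert_union, hB]

/-- The ends of the left-over edges that can be reached. -/
def IsReachEnd (p q : β → α) (a b : ℕ) (I₀ J₀ : Finset β) (e₀ : β) (v : α) : Prop :=
  ∃ I J e, Reach p q a b I₀ J₀ e₀ I J e ∧ (p e = v ∨ q e = v)

/-- The edges in a tight set connect it, and `T` has at least two vertices. Hence some edge in `T`
ends at `v`, and it can be made the left-over edge. -/
lemma Reach.isReachEnd_of_isSpan {T : Finset α} (ha : 1 ≤ a)
    (h : Reach p q a b I₀ J₀ e₀ I J e) (hI : Sparse p q a I) (hne : p e ≠ q e)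
    (hT : IsSpan p q a I e T) {v : α} (hv : v ∈ T) : IsReachEnd p q a b I₀ J₀ e₀ v := by
  have hnot : ¬ T ⊆ {v} := fun hs => by
    have h1 := mem_singleton.1 (hs hT.2.1)
    have h2 := mem_singleton.1 (hs hT.2.2.1)
    exact hne (h1.trans h2.symm)
  obtain ⟨f, hf, hfv⟩ := hT.1.exists_crossing ha hI (X := {v}) ⟨v, by simp [hv]⟩ hnot
  refine ⟨_, _, f, h.left hT hf, ?_⟩
  simp only [mem_singleton] at hfv
  tauto

/-- Let `W` be a maximal tight subset of `U` around `e₀`. Exchanges in `I` stay inside `W`. If the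
span in `J` left `W`, an exchange there could make an edge across `W` the left-over one, and its
span in `I` would enlarge `W`. So every left-over edge lies in `W`, and `W = U`. -/
lemma tight_of_reach {U : Finset α} (ha : 1 ≤ a) (hb : 1 ≤ b)
    (hne : ∀ e ∈ B, p e ≠ q e)
    (h₀ : SplitsUpTo p q a b B I₀ J₀ e₀)
    (hno : ¬ ∃ I J, Disjoint I J ∧ I ∪ J = B ∧ Sparse p q a I ∧ Sparse p q b J)
    (hU : ∀ v, v ∈ U ↔ IsReachEnd p q a b I₀ J₀ e₀ v) : Tight p q a I₀ U := by
  have hspan : ∀ {I J e T}, Reach p q a b I₀ J₀ e₀ I J e → IsSpan p q a I e T → T ⊆ U := by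
    intro I J e T hr hT v hv
    have hs := hr.splitsUpTo h₀
    rw [hU]
    exact hr.isReachEnd_of_isSpan ha hs.1 (hne e (by rw [← hs.2.2.2.2.2]; simp)) hT hv
  obtain ⟨T₀, hT₀⟩ := h₀.exists_isSpan hno
  obtain ⟨W, hW, hmax⟩ := exists_maximalFor_of_wellFoundedGT
    (fun W : {W : Finset α // W ⊆ U} => Tight p q a I₀ W.1 ∧ p e₀ ∈ W.1 ∧ q e₀ ∈ W.1)
    (fun W => (⟨#W.1, Nat.lt_succ_of_le (card_le_card W.2)⟩ : Fin (#U).succ))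
    ⟨⟨T₀, hspan .refl hT₀⟩, hT₀.1, hT₀.2.1, hT₀.2.2.1⟩
  obtain ⟨W, hWU⟩ := W
  simp only at hW hmax
  have hmax' : ∀ Z, Z ⊆ U → W ⊆ Z → Tight p q a I₀ Z → Z ⊆ W := by
    intro Z hZU hWZ hZ
    have := hmax (j := ⟨Z, hZU⟩) ⟨hZ, hWZ hW.2.1, hWZ hW.2.2⟩
      (by simpa [Fin.le_def] using card_le_card hWZ)
    rw [eq_of_subset_of_card_le hWZ (by simpa [Fin.le_def] using this)]
  -- The invariant includes the edge counts of all supersets of `W`, because tightness must be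
  -- transferred between `I` and `I₀` for `W` and also for its enlargements.
  have key : ∀ {I J e}, Reach p q a b I₀ J₀ e₀ I J e → (p e ∈ W ∧ q e ∈ W) ∧
      ∀ Z, W ⊆ Z → #(inside p q I Z) = #(inside p q I₀ Z) := by
    intro I J e hr
    induction hr with
    | refl => exact ⟨hW.2, fun _ _ => rfl⟩
    | @left I J e T f hr hT hf ih =>
      have hs := hr.splitsUpTo h₀
      have hWt : Tight p q a I W := ⟨hW.1.1, by rw [ih.2 W Subset.rfl]; exact hW.1.2⟩
      have hTW := hT.2.2.2 W hWt ih.1.1 ih.1.2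
      have hfW := inside_mono Subset.rfl hTW hf
      refine ⟨(mem_inside.1 hfW).2, fun Z hZ => ?_⟩
      rw [card_inside_exchange (inside_mono Subset.rfl hZ hfW) hs.2.2.2.1 (hZ ih.1.1) (hZ ih.1.2),
        ih.2 Z hZ]
    | @right I J e T g hr hT hg ih =>
      have hs := hr.splitsUpTo h₀
      refine ⟨?_, ih.2⟩
      have hWt : Tight p q a I W := ⟨hW.1.1, by rw [ih.2 W Subset.rfl]; exact hW.1.2⟩
      have hTW : T ⊆ W := by
        by_contra hnot
        obtain ⟨f, hf, hfW⟩ := hT.1.exists_crossing hb hs.2.1 (X := W)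
          ⟨p e, mem_inter.2 ⟨hT.2.1, ih.1.1⟩⟩ hnot
        have hr' := hr.right hT hf
        obtain ⟨T', hT'⟩ := (hr'.splitsUpTo h₀).exists_isSpan hno
        have hT'U := hspan hr' hT'
        have hne : (W ∩ T').Nonempty := by
          rcases hfW with h | h
          · exact ⟨p f, mem_inter.2 ⟨h.1, hT'.2.1⟩⟩
          · exact ⟨q f, mem_inter.2 ⟨h.2, hT'.2.2.1⟩⟩
        have hu := hWt.union hs.1 hT'.1 hne
        have hsub := hmax' _ (union_subset hWU hT'U) subset_union_left
          ⟨hu.1, by rw [← ih.2 _ subset_union_left]; exact hu.2⟩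
        have h1 := hsub (mem_union_right _ hT'.2.1)
        have h2 := hsub (mem_union_right _ hT'.2.2.1)
        tauto
      have := (mem_inside.1 hg).2
      exact ⟨hTW this.1, hTW this.2⟩
  have hUW : U ⊆ W := by
    intro v hv
    obtain ⟨I, J, e, hr, hv⟩ := (hU v).1 hv
    rcases hv with rfl | rfl
    · exact (key hr).1.1
    · exact (key hr).1.2
  rw [hUW.antisymm hWU]
  exact hW.1

/-- An `(a + b)`-sparse edge set splits into an `a`-sparse and a `b`-sparse one. -/
theorem Sparse.exists_split (ha : 1 ≤ a) (hb : 1 ≤ b) (hB : Sparse p q (a + b) B) :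
    ∃ I J, Disjoint I J ∧ I ∪ J = B ∧ Sparse p q a I ∧ Sparse p q b J := by
  induction B using Finset.induction_on with
  | empty => exact ⟨∅, ∅, by simp, by simp, sparse_empty, sparse_empty⟩
  | insert e₀ B he ih =>
    by_contra hno
    obtain ⟨I₀, J₀, hd, hun, hI, hJ⟩ := ih (hB.mono (subset_insert _ _))
    have h₀ : SplitsUpTo p q a b (insert e₀ B) I₀ J₀ e₀ :=
      ⟨hI, hJ, hd, fun h => he (hun ▸ mem_union_left _ h), fun h => he (hun ▸ mem_union_right _ h),
        by rw [hun]⟩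
    have hne : ∀ e ∈ insert e₀ B, p e ≠ q e := fun e h => hB.ne h
    classical
    set U : Finset α := ((insert e₀ B).image p ∪ (insert e₀ B).image q).filter
      (IsReachEnd p q a b I₀ J₀ e₀) with hUdef
    have hU : ∀ v, v ∈ U ↔ IsReachEnd p q a b I₀ J₀ e₀ v := by
      intro v
      simp only [hUdef, mem_filter, and_iff_right_iff_imp]
      rintro ⟨I, J, e, hr, hv⟩
      have heB : e ∈ insert e₀ B := by
        have := (hr.splitsUpTo h₀).2.2.2.2.2
        rw [← this]; exact mem_insert_self _ _
      rcases hv with rfl | rfl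
      · exact mem_union_left _ (mem_image_of_mem _ heB)
      · exact mem_union_right _ (mem_image_of_mem _ heB)
    have t1 := tight_of_reach ha hb hne h₀ hno hU
    have t2 := tight_of_reach hb ha hne h₀.swap
      (fun ⟨I, J, h1, h2, h3, h4⟩ => hno ⟨J, I, h1.symm, by rw [union_comm]; exact h2, h4, h3⟩)
      (U := U) (fun v => by
        rw [hU]
        constructor
        · rintro ⟨I, J, e, hr, hv⟩; exact ⟨J, I, e, hr.swap, hv⟩
        · rintro ⟨I, J, e, hr, hv⟩; exact ⟨J, I, e, hr.swap, hv⟩)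
    have hp : p e₀ ∈ U := (hU _).2 ⟨_, _, _, .refl, .inl rfl⟩
    have hq : q e₀ ∈ U := (hU _).2 ⟨_, _, _, .refl, .inr rfl⟩
    -- `U` is tight for both classes, so `B` already has `(a + b) (|U| - 1)` edges in `U`, and `e₀`
    -- is one too many.
    have h3 := hB U ⟨_, hp⟩
    rw [inside_insert ⟨hp, hq⟩, card_insert_of_notMem (fun h => he (mem_inside.1 h).1)] at h3
    have h4 : inside p q I₀ U ∪ inside p q J₀ U ⊆ inside p q B U :=
      union_subset (inside_mono (hun ▸ subset_union_left) Subset.rfl)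
        (inside_mono (hun ▸ subset_union_right) Subset.rfl)
    have h5 := card_le_card h4
    rw [card_union_of_disjoint (hd.mono inside_subset inside_subset)] at h5
    have h6 := t1.2
    have h7 := t2.2
    rw [add_mul] at h3
    omega

/-- **Nash-Williams**: an `(m, m)`-sparse edge set is a disjoint union of `m` forests. -/
theorem Sparse.exists_forests {m : ℕ} (hm : 1 ≤ m) (hB : Sparse p q m B) :
    ∃ T : Fin m → Finset β, (∀ i, T i ⊆ B ∧ Sparse p q 1 (T i)) ∧
      (Pairwise fun i j => Disjoint (T i) (T j)) ∧ ∑ i, #(T i) = #B := by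
  induction m, hm using Nat.le_induction generalizing B with
  | base => exact ⟨fun _ => B, fun _ => ⟨Subset.rfl, hB⟩,
      fun i j h => absurd (Subsingleton.elim i j) h, by simp⟩
  | succ m hm ih =>
    obtain ⟨I, J, hd, hun, hI, hJ⟩ := hB.exists_split hm le_rfl
    obtain ⟨T, hT, hdT, hsum⟩ := ih hI
    refine ⟨Fin.snoc T J, fun i => ?_, fun i j hij => ?_, ?_⟩
    · refine Fin.lastCases ?_ (fun i => ?_) i
      · simpa [hJ] using hun ▸ subset_union_right
      · simpa [(hT i).2] using (hT i).1.trans (hun ▸ subset_union_left)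
    · revert hij
      refine Fin.lastCases ?_ (fun i => ?_) i <;> refine Fin.lastCases ?_ (fun j => ?_) j
      · simp
      · intro _; simpa using (hd.mono_left (hT j).1).symm
      · intro _; simpa using hd.mono_left (hT i).1
      · intro hij; simpa using hdT (fun h => hij (by rw [h]))
    · rw [Fin.sum_univ_castSucc]
      simp [hsum, ← hun, card_union_of_disjoint hd]

end EdgeSparse

/-! ### Maximum feasible matchings and their closed sets -/

namespace EdgeSparse

open Finset

variable {α β : Type*} [DecidableEq α] [DecidableEq β]

/-- `v` is an end of `e`. -/
def Inc (p q : β → α) (e : β) (v : α) : Prop := p e = v ∨ q e = v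

/-- `M ⊆ N` is a matching that avoids the vertex `u` and whose union with `B` is sparse. -/
structure Feasible (p q : β → α) (m : ℕ) (B N : Finset β) (u : α) (M : Finset β) : Prop where
  subset : M ⊆ N
  eq_of_inc : ∀ e ∈ M, ∀ f ∈ M, ∀ v, Inc p q e v → Inc p q f v → e = f
  not_inc : ∀ e ∈ M, ¬ Inc p q e u
  sparse : Sparse p q m (B ∪ M)

/-- `M` and `M'` have the same edges apart from those inside `R`. -/
def AgreeOff (p q : β → α) (M M' : Finset β) (R : Finset α) : Prop :=
  ∀ e, ¬ (p e ∈ R ∧ q e ∈ R) → (e ∈ M ↔ e ∈ M')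

variable {p q : β → α} {m : ℕ} {B N M M' : Finset β} {u : α} {R X Y Z W V : Finset α}

/-- The edges not inside `Z` are the same for both sets, so equal totals force equal counts inside.
-/
lemma AgreeOff.card_inside (h : AgreeOff p q M M' R) (hB : Disjoint B M) (hB' : Disjoint B M')
    (hcard : #M = #M') (hRZ : R ⊆ Z) :
    #(inside p q (B ∪ M) Z) = #(inside p q (B ∪ M') Z) := by
  have h1 : (B ∪ M) \ inside p q (B ∪ M) Z = (B ∪ M') \ inside p q (B ∪ M') Z := by
    ext e
    have h2 : ¬ (p e ∈ Z ∧ q e ∈ Z) → (e ∈ M ↔ e ∈ M') :=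
      fun hn => h e fun hR => hn ⟨hRZ hR.1, hRZ hR.2⟩
    simp only [mem_sdiff, mem_inside, mem_union]
    tauto
  have h2 := card_sdiff_add_card_eq_card (inside_subset (p := p) (q := q) (B := B ∪ M) (X := Z))
  have h3 := card_sdiff_add_card_eq_card (inside_subset (p := p) (q := q) (B := B ∪ M') (X := Z))
  rw [card_union_of_disjoint hB] at h2
  rw [card_union_of_disjoint hB'] at h3
  rw [h1] at h2
  omega

lemma AgreeOff.tight (h : AgreeOff p q M M' R) (hB : Disjoint B M) (hB' : Disjoint B M')
    (hcard : #M = #M') (hRZ : R ⊆ Z) (hZ : Tight p q m (B ∪ M) Z) :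
    Tight p q m (B ∪ M') Z :=
  ⟨hZ.1, by rw [← h.card_inside hB hB' hcard hRZ]; exact hZ.2⟩

lemma AgreeOff.symm (h : AgreeOff p q M M' R) : AgreeOff p q M' M R := fun e he => (h e he).symm

/-- Rearrangements of `M` inside two disjoint tight sets can be carried out simultaneously. -/
lemma exists_combination {Mx My : Finset β} {x y : α} (hBN : Disjoint B N)
    (hM : Feasible p q m B N u M) (hXY : Disjoint X Y)
    (hX : Tight p q m (B ∪ M) X) (hY : Tight p q m (B ∪ M) Y) (hxX : x ∈ X) (hyY : y ∈ Y)
    (hMx : Feasible p q m B N u Mx) (hMy : Feasible p q m B N u My)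
    (hcx : #Mx = #M) (hcy : #My = #M)
    (hx : ∀ e ∈ Mx, ¬ Inc p q e x) (hy : ∀ e ∈ My, ¬ Inc p q e y)
    (hax : AgreeOff p q Mx M X) (hay : AgreeOff p q My M Y) :
    ∃ K, Feasible p q m B N u K ∧ #K = #M ∧ (∀ e ∈ K, ¬ Inc p q e x) ∧
      (∀ e ∈ K, ¬ Inc p q e y) ∧ (∀ e, ¬ (p e ∈ X ∧ q e ∈ X) → ¬ (p e ∈ Y ∧ q e ∈ Y) →
        (e ∈ K ↔ e ∈ M)) ∧ Tight p q m (B ∪ K) X ∧ Tight p q m (B ∪ K) Y := by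
  have hdj : ∀ v, v ∈ X → v ∈ Y → False := fun v h1 h2 => disjoint_left.1 hXY h1 h2
  -- Follow `My` inside `Y` and `Mx` elsewhere. Since `Mx` agrees with `M` off `X` and `My` off `Y`,
  -- the two pieces fit together as a matching.
  set K := (Mx \ inside p q Mx Y) ∪ inside p q My Y with hK
  have memK : ∀ e, e ∈ K ↔ (p e ∈ Y ∧ q e ∈ Y ∧ e ∈ My) ∨ (¬ (p e ∈ Y ∧ q e ∈ Y) ∧ e ∈ Mx) := by
    intro e
    simp only [hK, mem_union, mem_sdiff, mem_inside]
    tauto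
  have hagree : ∀ e, ¬ (p e ∈ X ∧ q e ∈ X) → ¬ (p e ∈ Y ∧ q e ∈ Y) → (e ∈ K ↔ e ∈ M) := by
    intro e h1 h2
    rw [memK, ← hax e h1]
    tauto
  have hKx : AgreeOff p q Mx K Y := fun e he => by rw [memK]; tauto
  have hsub : K ⊆ N := fun e he => by
    rcases (memK e).1 he with h | h
    · exact hMy.subset h.2.2
    · exact hMx.subset h.2
  have hBM := hBN.mono_right hM.subset
  have hBx := hBN.mono_right hMx.subset
  have hBy := hBN.mono_right hMy.subset
  have hBK := hBN.mono_right hsub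
  have hYx : inside p q (B ∪ Mx) Y = inside p q (B ∪ M) Y := by
    ext e
    simp only [mem_inside, mem_union, and_congr_left_iff]
    intro he
    rw [hax e fun h => hdj _ h.1 he.1]
  have hYx' : inside p q Mx Y = inside p q M Y := by
    ext e
    simp only [mem_inside, and_congr_left_iff]
    intro he
    rw [hax e fun h => hdj _ h.1 he.1]
  have htYx : Tight p q m (B ∪ Mx) Y := ⟨hY.1, by rw [hYx]; exact hY.2⟩
  have hcard : #K = #M := by
    have h1 : Disjoint (Mx \ inside p q Mx Y) (inside p q My Y) := by
      rw [disjoint_left]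
      intro e h1 h2
      rw [mem_sdiff, mem_inside] at h1
      exact h1.2 ⟨h1.1, (mem_inside.1 h2).2⟩
    have h2 : My \ inside p q My Y = M \ inside p q M Y := by
      ext e
      have := hay e
      simp only [mem_sdiff, mem_inside]
      tauto
    have h3 := card_sdiff_add_card_eq_card (inside_subset (p := p) (q := q) (B := My) (X := Y))
    have h4 := card_sdiff_add_card_eq_card (inside_subset (p := p) (q := q) (B := M) (X := Y))
    have h5 := card_sdiff_add_card_eq_card (inside_subset (p := p) (q := q) (B := Mx) (X := Y))
    rw [hK, card_union_of_disjoint h1]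
    rw [h2] at h3
    rw [hYx'] at h5 ⊢
    omega
  refine ⟨K, ⟨hsub, ?_, ?_, ?_⟩, hcard, ?_, ?_, hagree, ?_, ?_⟩
  · have hmix : ∀ e f v, (p e ∈ Y ∧ q e ∈ Y ∧ e ∈ My) → (¬ (p f ∈ Y ∧ q f ∈ Y) ∧ f ∈ Mx) →
        Inc p q e v → Inc p q f v → e = f := by
      intro e f v he hf hev hfv
      have hvY : v ∈ Y := by rcases hev with rfl | rfl; exacts [he.1, he.2.1]
      have hfX : ¬ (p f ∈ X ∧ q f ∈ X) := by
        rintro ⟨h1, h2⟩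
        rcases hfv with rfl | rfl
        exacts [hdj _ h1 hvY, hdj _ h2 hvY]
      have hfy : f ∈ My := (hay f hf.1).2 ((hax f hfX).1 hf.2)
      exact hMy.eq_of_inc e he.2.2 f hfy v hev hfv
    intro e he f hf v hev hfv
    rcases (memK e).1 he with he | he <;> rcases (memK f).1 hf with hf | hf
    · exact hMy.eq_of_inc e he.2.2 f hf.2.2 v hev hfv
    · exact hmix e f v he hf hev hfv
    · exact (hmix f e v hf he hfv hev).symm
    · exact hMx.eq_of_inc e he.2 f hf.2 v hev hfv
  · intro e he
    rcases (memK e).1 he with h | h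
    · exact hMy.not_inc e h.2.2
    · exact hMx.not_inc e h.2
  · have := hMx.sparse.replace htYx (D := inside p q (B ∪ My) Y)
      (hMy.sparse.mono inside_subset) (fun e he => (mem_inside.1 he).2)
    refine this.mono fun e he => ?_
    have := memK e
    simp only [mem_union, mem_sdiff, mem_inside] at he ⊢
    tauto
  · intro e he hinc
    rcases (memK e).1 he with h | h
    · rcases hinc with rfl | rfl
      exacts [hdj _ hxX h.1, hdj _ hxX h.2.1]
    · exact hx e h.2 hinc
  · intro e he hinc
    rcases (memK e).1 he with h | h
    · exact hy e h.2.2 hinc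
    · refine hy e ((hay e h.1).2 ((hax e ?_).1 h.2)) hinc
      rintro ⟨h1, h2⟩
      rcases hinc with rfl | rfl
      exacts [hdj _ h1 hyY, hdj _ h2 hyY]
  · have h1 : Tight p q m (B ∪ Mx) X := hax.symm.tight hBM hBx hcx.symm Subset.rfl hX
    refine ⟨h1.1, ?_⟩
    rw [← h1.2]
    congr 2
    ext e
    simp only [mem_inside, mem_union, and_congr_left_iff]
    intro he
    rw [hKx e fun h => hdj _ he.1 h.1]
  · exact hKx.tight hBx hBK (hcx.trans hcard.symm) Subset.rfl htYx

/-- Every vertex of `W` can be missed by a matching as large as `M` that differs from `M` only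
inside a tight set around that vertex. -/
structure Freeable (p q : β → α) (m : ℕ) (B N : Finset β) (u : α) (V : Finset α) (M : Finset β)
    (W : Finset α) : Prop where
  subset : W ⊆ V
  notMem : u ∉ W
  covered : ∀ v ∈ V, v ≠ u → v ∉ W → ∃ e ∈ M, Inc p q e v
  exists_free : ∀ x ∈ W, ∃ X M', x ∈ X ∧ Tight p q m (B ∪ inside p q M W) X ∧
    Feasible p q m B N u M' ∧ #M' = #M ∧ (∀ e ∈ M', ¬ Inc p q e x) ∧ AgreeOff p q M' M X

/-- Both ends of `e₀` can be freed at once, since the tight sets around them are disjoint. By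
maximality `e₀` is then blocked by sparsity alone. Any matching edge in its span can be swapped for
`e₀`, which frees the ends of that edge; these ends enlarge `W`. -/
lemma Feasible.exists_freeable_insert {e₀ : β} (hBN : Disjoint B N)
    (hN : ∀ e ∈ N, p e ∈ V ∧ q e ∈ V)
    (hM : Feasible p q m B N u M) (hmax : ∀ M', Feasible p q m B N u M' → #M' ≤ #M)
    (hW : Freeable p q m B N u V M W) (he₀ : e₀ ∈ N) (hp : p e₀ ∈ W) (hq : q e₀ ∈ W)
    (hno : ¬ ∃ X, Tight p q m (B ∪ inside p q M W) X ∧ p e₀ ∈ X ∧ q e₀ ∈ X) :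
    ∃ W', Freeable p q m B N u V M W' ∧ W ⊂ W' := by
  obtain ⟨X, Mx, hxX, hX, hMx, hcx, hx, hax⟩ := hW.exists_free _ hp
  obtain ⟨Y, My, hyY, hY, hMy, hcy, hy, hay⟩ := hW.exists_free _ hq
  have hAB : B ∪ inside p q M W ⊆ B ∪ M := union_subset_union_right inside_subset
  have hA := hM.sparse.mono hAB
  have hXY : Disjoint X Y := by
    rw [disjoint_iff_inter_eq_empty]
    by_contra hne
    exact hno ⟨X ∪ Y, hX.union hA hY (nonempty_iff_ne_empty.2 hne),
      mem_union_left _ hxX, mem_union_right _ hyY⟩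
  obtain ⟨K, hK, hcK, hKx, hKy, hag, htX, htY⟩ := exists_combination hBN hM hXY
    (hX.mono hAB hM.sparse) (hY.mono hAB hM.sparse) hxX hyY hMx hMy hcx hcy hx hy hax hay
  have he₀K : e₀ ∉ K := fun h => hKx e₀ h (.inl rfl)
  have hBM := hBN.mono_right hM.subset
  have hBK := hBN.mono_right hK.subset
  have he₀B : e₀ ∉ B := fun h => disjoint_left.1 hBN h he₀
  have hmatch : ∀ K' ⊆ K, ∀ e ∈ insert e₀ K', ∀ f ∈ insert e₀ K', ∀ v,
      Inc p q e v → Inc p q f v → e = f := by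
    intro K' hK' e he f hf v hev hfv
    have hfree : ∀ g ∈ K, Inc p q g v → ¬ Inc p q e₀ v := by
      rintro g hg hgv (rfl | rfl)
      exacts [hKx g hg hgv, hKy g hg hgv]
    rcases mem_insert.1 he with he' | he' <;> rcases mem_insert.1 hf with hf' | hf'
    · rw [he', hf']
    · exact absurd (he' ▸ hev) (hfree f (hK' hf') hfv)
    · exact absurd (hf' ▸ hfv) (hfree e (hK' he') hev)
    · exact hK.eq_of_inc e (hK' he') f (hK' hf') v hev hfv
  have hu₀ : ¬ Inc p q e₀ u := by
    rintro (h | h)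
    exacts [hW.notMem (h ▸ hp), hW.notMem (h ▸ hq)]
  have hnotu : ∀ K' ⊆ K, ∀ e ∈ insert e₀ K', ¬ Inc p q e u := by
    intro K' hK' e he
    rcases mem_insert.1 he with rfl | he
    exacts [hu₀, hK.not_inc e (hK' he)]
  have hns : ¬ Sparse p q m (insert e₀ (B ∪ K)) := fun hs => by
    have := hmax (insert e₀ K) ⟨insert_subset he₀ hK.subset, hmatch K Subset.rfl,
      hnotu K Subset.rfl, by rwa [union_insert]⟩
    rw [card_insert_of_notMem he₀K] at this
    omega
  obtain ⟨T, hT⟩ := exists_isSpan hK.sparse hns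
  obtain ⟨ht1, -, hi1⟩ := hT.1.union_inter hK.sparse htX ⟨p e₀, mem_inter.2 ⟨hT.2.1, hxX⟩⟩
  obtain ⟨htZ, -, hi2⟩ := ht1.union_inter hK.sparse htY
    ⟨q e₀, mem_inter.2 ⟨mem_union_left _ hT.2.2.1, hyY⟩⟩
  rw [hi1] at hi2
  -- `K` differs from `M` only inside `Z`, so tightness of `Z` passes from `B ∪ K` to `B ∪ M`.
  set Z := T ∪ X ∪ Y with hZ
  have hpZ : p e₀ ∈ Z := mem_union_left _ (mem_union_left _ hT.2.1)
  have hqZ : q e₀ ∈ Z := mem_union_left _ (mem_union_left _ hT.2.2.1)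
  have hXZ : X ⊆ Z := (subset_union_right (s₁ := T)).trans subset_union_left
  have hYZ : Y ⊆ Z := subset_union_right
  have hagZ : AgreeOff p q K M Z := fun e he =>
    hag e (fun h => he ⟨hXZ h.1, hXZ h.2⟩) (fun h => he ⟨hYZ h.1, hYZ h.2⟩)
  have htZM : Tight p q m (B ∪ M) Z := hagZ.tight hBK hBM hcK Subset.rfl htZ
  set W' := W ∪ (inside p q M Z).image p ∪ (inside p q M Z).image q with hW'
  have hWW' : W ⊆ W' := subset_union_left.trans subset_union_left
  have hendsW' : ∀ e ∈ inside p q M Z, p e ∈ W' ∧ q e ∈ W' := fun e he =>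
    ⟨mem_union_left _ (mem_union_right _ (mem_image_of_mem _ he)),
      mem_union_right _ (mem_image_of_mem _ he)⟩
  have hA'B : B ∪ inside p q M W' ⊆ B ∪ M := union_subset_union_right inside_subset
  have hZ' : ∀ W'', (∀ e ∈ inside p q M Z, p e ∈ W'' ∧ q e ∈ W'') →
      Tight p q m (B ∪ inside p q M W'') Z := by
    intro W'' h
    refine ⟨htZM.1, ?_⟩
    rw [← htZM.2]
    congr 2
    ext e
    have := h e
    simp only [mem_inside, mem_union] at this ⊢
    tauto
  refine ⟨W', ⟨?_, ?_, ?_, ?_⟩, ?_⟩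
  · refine union_subset (union_subset hW.subset ?_) ?_ <;> rw [image_subset_iff] <;> intro e he
    · exact (hN e (hM.subset (inside_subset he))).1
    · exact (hN e (hM.subset (inside_subset he))).2
  · intro h
    simp only [hW', mem_union, mem_image] at h
    rcases h with (h | ⟨e, he, h⟩) | ⟨e, he, h⟩
    · exact hW.notMem h
    · exact hM.not_inc e (inside_subset he) (.inl h)
    · exact hM.not_inc e (inside_subset he) (.inr h)
  · exact fun v hv hvu hvW => hW.covered v hv hvu fun h => hvW (hWW' h)
  · intro v hv
    by_cases hvW : v ∈ W
    · obtain ⟨X', M', h1, h2, h3⟩ := hW.exists_free v hvW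
      exact ⟨X', M', h1, h2.mono (union_subset_union_right (inside_mono Subset.rfl hWW'))
        (hM.sparse.mono hA'B), h3⟩
    · have hvf : ∃ f ∈ inside p q M Z, Inc p q f v := by
        simp only [hW', mem_union, mem_image] at hv
        rcases hv with (h | ⟨e, he, h⟩) | ⟨e, he, h⟩
        · exact absurd h hvW
        · exact ⟨e, he, .inl h⟩
        · exact ⟨e, he, .inr h⟩
      obtain ⟨f, hfZ, hfv⟩ := hvf
      have hfM : f ∈ M := inside_subset hfZ
      have hfB : f ∉ B := fun h => disjoint_left.1 hBM h hfM
      -- A set that is tight for `B ∪ M[W]` spans no further edge of `B ∪ M`, and `f` is not in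
      -- `M[W]` because its end `v` is outside `W`.
      have hfnot : ∀ X', Tight p q m (B ∪ inside p q M W) X' → ¬ (p f ∈ X' ∧ q f ∈ X') := by
        intro X' hX' hf
        have h1 : f ∈ inside p q (B ∪ M) X' := mem_inside.2 ⟨mem_union_right _ hfM, hf⟩
        rw [hX'.inside_eq hAB hM.sparse, mem_inside, mem_union, mem_inside] at h1
        have h2 := (h1.1.resolve_left hfB).2
        rcases hfv with rfl | rfl
        exacts [hvW h2.1, hvW h2.2]
      have hfK : f ∈ K := (hag f (hfnot X hX) (hfnot Y hY)).2 hfM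
      -- Every edge in `Z` lies in `T`, `X` or `Y`, and the last two are excluded. So `f` is in the
      -- span of `e₀` and may be exchanged.
      have hfT : f ∈ inside p q (B ∪ K) T := by
        have h1 : f ∈ inside p q (B ∪ K) Z :=
          mem_inside.2 ⟨mem_union_right _ hfK, (mem_inside.1 hfZ).2⟩
        rw [hi2, mem_union, mem_union] at h1
        rcases h1 with (h1 | h1) | h1
        · exact h1
        · exact absurd (mem_inside.1 h1).2 (hfnot X hX)
        · exact absurd (mem_inside.1 h1).2 (hfnot Y hY)
      have hsp := hT.exchange hK.sparse (by simp [he₀B, he₀K]) hfT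
      refine ⟨Z, insert e₀ (K.erase f), ?_, hZ' W' hendsW', ⟨?_, ?_, ?_, ?_⟩, ?_, ?_, ?_⟩
      · rcases hfv with rfl | rfl
        exacts [(mem_inside.1 hfZ).2.1, (mem_inside.1 hfZ).2.2]
      · exact insert_subset he₀ ((erase_subset _ _).trans hK.subset)
      · exact hmatch _ (erase_subset _ _)
      · exact hnotu _ (erase_subset _ _)
      · rwa [erase_union_distrib, erase_eq_of_notMem hfB, ← union_insert] at hsp
      · rw [card_insert_of_notMem (by simp [he₀K]), card_erase_add_one hfK, hcK]
      · intro g hg hgv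
        rcases mem_insert.1 hg with rfl | hg
        · rcases hgv with rfl | rfl
          exacts [hvW hp, hvW hq]
        · rw [mem_erase] at hg
          exact hg.1 (hK.eq_of_inc g hg.2 f hfK v hgv hfv)
      · intro e he
        have h1 : e ≠ e₀ := by rintro rfl; exact he ⟨hpZ, hqZ⟩
        have h2 : e ≠ f := by rintro rfl; exact he (mem_inside.1 hfZ).2
        rw [← hagZ e he]
        simp [h1, h2]
  -- If nothing new were added, `Z` would already be tight for `B ∪ M[W]` and would span `e₀`.
  · refine hWW'.ssubset_of_ne fun heq => hno ⟨Z, hZ' W fun e he => ?_, hpZ, hqZ⟩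
    rw [heq]
    exact hendsW' e he

/-- A maximum feasible matching `M` has a vertex set `W` that contains the vertices other than `u`
it misses, such that every further edge inside `W` is spanned by the edges inside `W`. -/
theorem Feasible.exists_freeable (hBN : Disjoint B N) (hN : ∀ e ∈ N, p e ∈ V ∧ q e ∈ V)
    (hM : Feasible p q m B N u M) (hmax : ∀ M', Feasible p q m B N u M' → #M' ≤ #M) :
    ∃ W ⊆ V, u ∉ W ∧ (∀ v ∈ V, v ≠ u → v ∉ W → ∃ e ∈ M, Inc p q e v) ∧
      ∀ e ∈ N, p e ∈ W → q e ∈ W →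
        ∃ X, Tight p q m (B ∪ inside p q M W) X ∧ p e ∈ X ∧ q e ∈ X := by
  classical
  have hne : ∃ W ∈ V.powerset, Freeable p q m B N u V M W := by
    -- Start with the missed vertices: `M` itself frees each of them, with a singleton as its tight
    -- set.
    refine ⟨V.filter fun v => v ≠ u ∧ ¬ ∃ e ∈ M, Inc p q e v, by simp, by simp, by simp, ?_, ?_⟩
    · intro v hv hvu hvW
      by_contra h
      exact hvW (mem_filter.2 ⟨hv, hvu, h⟩)
    · intro x hx
      rw [mem_filter] at hx
      refine ⟨{x}, M, mem_singleton_self x,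
        Sparse.tight_singleton (hM.sparse.mono (union_subset_union_right inside_subset)) x, hM, rfl,
        fun e he h => hx.2.2 ⟨e, he, h⟩, fun _ _ => Iff.rfl⟩
  obtain ⟨W, hWmax⟩ := (V.powerset.filter fun W => Freeable p q m B N u V M W).exists_maximal
    (by obtain ⟨W, h1, h2⟩ := hne; exact ⟨W, mem_filter.2 ⟨h1, h2⟩⟩)
  have hW := (mem_filter.1 hWmax.prop).2
  refine ⟨W, hW.subset, hW.notMem, hW.covered, fun e he hp hq => ?_⟩
  by_contra hno
  obtain ⟨W', hW', hlt⟩ := hM.exists_freeable_insert hBN hN hmax hW he hp hq hno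
  exact hWmax.not_gt (mem_filter.2 ⟨mem_powerset.2 hW'.subset, hW'⟩) hlt

end EdgeSparse

/-! ### Partition into maximal tight sets, and edge counts between its members -/

namespace EdgeSparse

open Finset

variable {α β : Type*} [DecidableEq α] [DecidableEq β]

/-- The edges of `X` that go from `A` to `R`. -/
def links (p q : β → α) (X : Finset β) (A R : Finset α) : Finset β :=
  X.filter fun e => p e ∈ A ∧ q e ∈ R

/-- The number of edges of `X` between `A` and `R`; edges inside `A ∩ R` are counted twice. -/
def between (p q : β → α) (X : Finset β) (A R : Finset α) : ℕ :=
  #(links p q X A R) + #(links p q X R A)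

/-- The edges of `A` that are not inside a member of `P`. -/
def crossing (p q : β → α) (P : Finset (Finset α)) (A : Finset β) : Finset β :=
  A.filter fun e => ∀ C ∈ P, ¬ (p e ∈ C ∧ q e ∈ C)

/-- `P` is the partition of `V` into the maximal tight sets of `A`. -/
structure IsTightPartition (p q : β → α) (m : ℕ) (A : Finset β) (V : Finset α)
    (P : Finset (Finset α)) : Prop where
  tight : ∀ C ∈ P, Tight p q m A C
  disjoint : (P : Set (Finset α)).PairwiseDisjoint id
  biUnion : P.biUnion id = V
  exists_superset : ∀ T, Tight p q m A T → T ⊆ V → ∃ C ∈ P, T ⊆ C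

variable {p q : β → α} {m : ℕ} {A X : Finset β} {V R R' S S' U : Finset α} {P Q : Finset (Finset α)}
  {e : β}

lemma mem_links : e ∈ links p q X S R ↔ e ∈ X ∧ p e ∈ S ∧ q e ∈ R := by
  simp [links]

lemma mem_crossing : e ∈ crossing p q P A ↔ e ∈ A ∧ ∀ C ∈ P, ¬ (p e ∈ C ∧ q e ∈ C) := by
  simp [crossing]

lemma links_mono (hS : S ⊆ S') (hR : R ⊆ R') : links p q X S R ⊆ links p q X S' R' := by
  intro e he
  rw [mem_links] at he ⊢
  exact ⟨he.1, hS he.2.1, hR he.2.2⟩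

lemma between_mono (hS : S ⊆ S') (hR : R ⊆ R') : between p q X S R ≤ between p q X S' R' :=
  Nat.add_le_add (card_le_card (links_mono hS hR)) (card_le_card (links_mono hR hS))

lemma between_comm : between p q X S R = between p q X R S := Nat.add_comm _ _

lemma between_union (h : Disjoint R R') :
    between p q X S (R ∪ R') = between p q X S R + between p q X S R' := by
  have h1 : links p q X S (R ∪ R') = links p q X S R ∪ links p q X S R' := by
    ext e; simp only [mem_links, mem_union]; tauto
  have h2 : links p q X (R ∪ R') S = links p q X R S ∪ links p q X R' S := by
    ext e; simp only [mem_links, mem_union]; tauto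
  rw [between, h1, h2, card_union_of_disjoint, card_union_of_disjoint, between, between]
  · omega
  all_goals
    rw [disjoint_left]
    intro e h3 h4
    rw [mem_links] at h3 h4
  · exact disjoint_left.1 h h3.2.1 h4.2.1
  · exact disjoint_left.1 h h3.2.2 h4.2.2

lemma sum_between (hQ : (Q : Set (Finset α)).PairwiseDisjoint id) :
    ∑ C ∈ Q, between p q X C R = between p q X (Q.biUnion id) R := by
  induction Q using Finset.induction_on with
  | empty => simp [between, links]
  | insert C Q hC ih =>
    rw [coe_insert, Set.pairwiseDisjoint_insert_of_notMem (by simpa using hC)] at hQ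
    rw [sum_insert hC, ih hQ.1, biUnion_insert, between_comm (S := _ ∪ _), between_union,
      between_comm, between_comm (S := R)]
    · simp [between_comm]
    · rw [disjoint_biUnion_right]
      exact fun D hD => hQ.2 D (by simpa using hD)

lemma between_self : between p q X S S = 2 * #(links p q X S S) := by
  rw [between]; omega

/-- If each vertex of `U` is joined to `R` by an edge of `X`, then `U` is not larger than the number
of edges between `U` and `R`. -/
lemma card_le_between (hUR : Disjoint U R)
    (h : ∀ v ∈ U, ∃ e ∈ X, (p e = v ∧ q e ∈ R) ∨ (q e = v ∧ p e ∈ R)) :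
    #U ≤ between p q X U R := by
  rcases U.eq_empty_or_nonempty with rfl | ⟨v₀, hv₀⟩
  · simp
  have : Nonempty β := ⟨(h v₀ hv₀).choose⟩
  choose! g hg hgv using h
  have hinj : Set.InjOn g (U : Set α) := by
    intro v hv w hw hvw
    have h1 := hgv v hv
    have h2 := hgv w hw
    rw [← hvw] at h2
    rcases h1 with h1 | h1 <;> rcases h2 with h2 | h2
    · exact h1.1.symm.trans h2.1
    · exact absurd h2.2 (disjoint_left.1 hUR (show p (g v) ∈ U by rw [h1.1]; exact hv))
    · exact absurd h2.2 (disjoint_left.1 hUR (show q (g v) ∈ U by rw [h1.1]; exact hv))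
    · exact h1.1.symm.trans h2.1
  rw [← card_image_of_injOn hinj]
  refine (card_le_card (t := links p q X U R ∪ links p q X R U) ?_).trans (card_union_le _ _)
  intro e he
  obtain ⟨v, hv, rfl⟩ := mem_image.1 he
  rw [mem_union, mem_links, mem_links]
  rcases hgv v hv with ⟨h1, h2⟩ | ⟨h1, h2⟩
  · exact .inl ⟨hg v hv, h1.symm ▸ hv, h2⟩
  · exact .inr ⟨hg v hv, h2, h1.symm ▸ hv⟩

/-- Tight sets that meet have a tight union, so the maximal ones are disjoint; they cover `V`
because singletons are tight. -/
lemma exists_isTightPartition (hA : Sparse p q m A) (V : Finset α) :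
    ∃ P, IsTightPartition p q m A V P := by
  classical
  set 𝒯 := V.powerset.filter fun T => Tight p q m A T with h𝒯
  have hsup : ∀ T, Tight p q m A T → T ⊆ V → ∃ C ∈ 𝒯.filter (Maximal (· ∈ 𝒯)), T ⊆ C := by
    intro T hT hTV
    obtain ⟨C, hTC, hC⟩ := 𝒯.exists_le_maximal (a := T) (by simp [h𝒯, hT, hTV])
    exact ⟨C, mem_filter.2 ⟨hC.prop, hC⟩, hTC⟩
  refine ⟨𝒯.filter (Maximal (· ∈ 𝒯)), ⟨?_, ?_, ?_, hsup⟩⟩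
  · intro C hC
    exact (mem_filter.1 (mem_filter.1 hC).1).2
  · intro C hC D hD hne
    rw [mem_coe, mem_filter] at hC hD
    have hC' := mem_filter.1 hC.1
    have hD' := mem_filter.1 hD.1
    by_contra hnd
    simp only [Function.onFun, id, disjoint_iff_inter_eq_empty] at hnd
    have hu := hC'.2.union hA hD'.2 (nonempty_iff_ne_empty.2 hnd)
    have hmem : C ∪ D ∈ 𝒯 := mem_filter.2 ⟨mem_powerset.2 (union_subset (mem_powerset.1 hC'.1)
      (mem_powerset.1 hD'.1)), hu⟩
    have h1 := hC.2.eq_of_le hmem subset_union_left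
    have h2 := hD.2.eq_of_le hmem subset_union_right
    exact hne (h1.trans h2.symm)
  · ext v
    simp only [mem_biUnion, id]
    constructor
    · rintro ⟨C, hC, hv⟩
      exact mem_powerset.1 (mem_filter.1 (mem_filter.1 hC).1).1 hv
    · intro hv
      obtain ⟨C, hC, hvC⟩ := hsup {v} (hA.tight_singleton v) (by simpa using hv)
      exact ⟨C, hC, hvC (mem_singleton_self v)⟩

namespace IsTightPartition

lemma subset (hP : IsTightPartition p q m A V P) {C : Finset α} (hC : C ∈ P) : C ⊆ V := by
  rw [← hP.biUnion]; exact subset_biUnion_of_mem id hC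

lemma eq_of_mem (hP : IsTightPartition p q m A V P) {C D : Finset α} (hC : C ∈ P) (hD : D ∈ P)
    {v : α} (hvC : v ∈ C) (hvD : v ∈ D) : C = D := by
  by_contra hne
  exact disjoint_left.1 (hP.disjoint hC hD hne) hvC hvD

lemma exists_mem (hP : IsTightPartition p q m A V P) {v : α} (hv : v ∈ V) : ∃ C ∈ P, v ∈ C := by
  rw [← hP.biUnion] at hv; simpa using hv

lemma maximal (hP : IsTightPartition p q m A V P) {C : Finset α} (hC : C ∈ P) :
    Maximal (fun T => Tight p q m A T ∧ T ⊆ V) C := by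
  refine ⟨⟨hP.tight C hC, hP.subset hC⟩, fun T hT hCT => ?_⟩
  obtain ⟨D, hD, hTD⟩ := hP.exists_superset T hT.1 hT.2
  obtain ⟨v, hv⟩ := (hP.tight C hC).1
  rw [hP.eq_of_mem hC hD hv (hTD (hCT hv))]
  exact hTD

/-- The edges inside a union of members of a tight partition. -/
lemma card_inside (hP : IsTightPartition p q m A V P) (hQ : Q ⊆ P) :
    #(inside p q A (Q.biUnion id)) + m * #Q =
      m * #(Q.biUnion id) + #(links p q (crossing p q P A) (Q.biUnion id) (Q.biUnion id)) := by
  have hdj : (Q : Set (Finset α)).PairwiseDisjoint id := hP.disjoint.subset (by simpa using hQ)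
  have h1 : inside p q A (Q.biUnion id) = Q.biUnion (inside p q A) ∪
      links p q (crossing p q P A) (Q.biUnion id) (Q.biUnion id) := by
    ext e
    rw [mem_union, mem_links, mem_inside, mem_crossing]
    simp only [mem_biUnion, id, mem_inside]
    constructor
    · rintro ⟨heA, hp, hq⟩
      by_cases h : ∃ C ∈ Q, p e ∈ C ∧ q e ∈ C
      · obtain ⟨C, hC, h⟩ := h
        exact .inl ⟨C, hC, heA, h⟩
      · refine .inr ⟨⟨heA, fun C hC hCe => h ?_⟩, hp, hq⟩
        obtain ⟨D, hD, hpD⟩ := hp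
        rw [hP.eq_of_mem hC (hQ hD) hCe.1 hpD] at hCe
        exact ⟨D, hD, hCe⟩
    · rintro (⟨C, hC, heA, h⟩ | h)
      · exact ⟨heA, ⟨C, hC, h.1⟩, ⟨C, hC, h.2⟩⟩
      · exact ⟨h.1.1, h.2⟩
  have h2 : Disjoint (Q.biUnion (inside p q A))
      (links p q (crossing p q P A) (Q.biUnion id) (Q.biUnion id)) := by
    rw [disjoint_left]
    intro e he he'
    rw [mem_links, mem_crossing] at he'
    obtain ⟨C, hC, h⟩ := mem_biUnion.1 he
    exact he'.1.2 C (hQ hC) (mem_inside.1 h).2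
  have h3 : #(Q.biUnion (inside p q A)) = ∑ C ∈ Q, #(inside p q A C) := by
    refine card_biUnion fun C hC D hD hne => ?_
    rw [Function.onFun, disjoint_left]
    intro e h1 h2
    exact disjoint_left.1 (hdj hC hD hne) (mem_inside.1 h1).2.1 (mem_inside.1 h2).2.1
  have h4 : ∑ C ∈ Q, (#(inside p q A C) + m) = m * #(Q.biUnion id) := by
    rw [card_biUnion hdj, mul_sum]
    exact sum_congr rfl fun C hC => (hP.tight C (hQ hC)).2
  rw [sum_add_distrib, sum_const, smul_eq_mul] at h4
  rw [h1, card_union_of_disjoint h2, h3, ← h4]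
  ring

end IsTightPartition

/-- A tight set that meets `V` lies in it. -/
lemma Tight.subset_of_mem (hm : 1 ≤ m) (hA : Sparse p q m A)
    (hV : ∀ e ∈ A, p e ∈ V ∧ q e ∈ V) {T : Finset α} (hT : Tight p q m A T) {v : α}
    (hvT : v ∈ T) (hvV : v ∈ V) : T ⊆ V := by
  by_contra hnot
  obtain ⟨f, hf, h⟩ := hT.exists_crossing hm hA (X := V) ⟨v, mem_inter.2 ⟨hvT, hvV⟩⟩ hnot
  have := hV f (inside_subset hf)
  tauto

/-- The number of edges of `F` with exactly one end in `C`. -/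
def boundary (p q : β → α) (F : Finset β) (C : Finset α) : ℕ :=
  #(F.filter fun e => (p e ∈ C ∧ q e ∉ C) ∨ (p e ∉ C ∧ q e ∈ C))

/-- For a union of members of the partition, boundary edges are crossing edges. -/
lemma boundary_eq_between {F : Finset β} (hF : ∀ e ∈ F, p e ∈ V ∧ q e ∈ V) {C : Finset α}
    (hC : ∀ D ∈ P, D ⊆ C ∨ Disjoint D C) :
    boundary p q F C = between p q (crossing p q P F) C (V \ C) := by
  rw [between, ← card_union_of_disjoint, boundary]
  · congr 1
    ext e
    simp only [mem_filter, mem_union, mem_links, mem_crossing, mem_sdiff]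
    constructor
    · rintro ⟨heF, h⟩
      have h1 : ∀ D ∈ P, ¬ (p e ∈ D ∧ q e ∈ D) := by
        rintro D hD ⟨hp, hq⟩
        rcases hC D hD with hDC | hDC
        · have := hDC hp
          have := hDC hq
          tauto
        · have := disjoint_left.1 hDC hp
          have := disjoint_left.1 hDC hq
          tauto
      have := hF e heF
      tauto
    · rintro (h | h)
      · exact ⟨h.1.1, .inl ⟨h.2.1, h.2.2.2⟩⟩
      · exact ⟨h.1.1, .inr ⟨h.2.1.2, h.2.2⟩⟩
  · rw [disjoint_left]
    intro e h1 h2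
    simp only [mem_links, mem_sdiff] at h1 h2
    exact h1.2.2.2 h2.2.2

lemma IsTightPartition.between_eq_boundary {F : Finset β} (hP : IsTightPartition p q m A V P)
    (hF : ∀ e ∈ F, p e ∈ V ∧ q e ∈ V) {D : Finset α} (hD : D ∈ P) :
    between p q (crossing p q P F) D V = boundary p q F D := by
  have hz : between p q (crossing p q P F) D D = 0 := by
    rw [between_self]
    simp only [mul_eq_zero, OfNat.ofNat_ne_zero, false_or, card_eq_zero]
    refine eq_empty_of_forall_notMem fun e he => ?_
    rw [mem_links, mem_crossing] at he
    exact he.1.2 D hD he.2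
  have hV : V = D ∪ (V \ D) := by rw [union_sdiff_of_subset (hP.subset hD)]
  rw [boundary_eq_between (V := V) (P := P) hF]
  · conv_lhs => rw [hV]
    rw [between_union disjoint_sdiff, hz, zero_add]
  · intro D' hD'
    by_cases h : D' = D
    · exact .inl (h ▸ Subset.rfl)
    · exact .inr (hP.disjoint hD' hD h)

/-- A lower bound on the order of the tree components carries over to unions of them. -/
lemma le_card_of_tight {F B₀ A : Finset β} {c : ℝ} (hm : 1 ≤ m) (hc : 1 ≤ c)
    (hF : ∀ e ∈ F, p e ∈ V ∧ q e ∈ V) (hB₀F : B₀ ⊆ F) (hB₀A : B₀ ⊆ A) (hA : Sparse p q m A)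
    (hspan : ∀ e ∈ F, e ∉ B₀ → ∃ X, Tight p q m B₀ X ∧ p e ∈ X ∧ q e ∈ X)
    (hsize : ∀ X, Maximal (fun T => Tight p q m B₀ T ∧ T ⊆ V) X →
      c - (c - 1) / (2 * (m : ℝ)) * (boundary p q F X : ℝ) ≤ (#X : ℝ))
    {P : Finset (Finset α)} (hP : IsTightPartition p q m A V P) {C : Finset α} (hC : C ∈ P) :
    (c - 1) * (1 - (boundary p q F C : ℝ) / (2 * m)) ≤ #C - 1 := by
  classical
  have hB₀ := hA.mono hB₀A
  obtain ⟨P₀, hP₀⟩ := exists_isTightPartition hB₀ V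
  -- Tight sets of `B₀` remain tight in `A`, so `P₀` refines `P`.
  have hsub : ∀ D ∈ P₀, D ⊆ C ∨ Disjoint D C := by
    intro D hD
    obtain ⟨C', hC', hDC'⟩ := hP.exists_superset D ((hP₀.tight D hD).mono hB₀A hA) (hP₀.subset hD)
    by_cases h : C' = C
    · exact .inl (h ▸ hDC')
    · exact .inr ((hP.disjoint hC' hC h).mono_left hDC')
  set Q := P₀.filter (· ⊆ C) with hQ
  have hQP : Q ⊆ P₀ := filter_subset _ _
  have hQC : Q.biUnion id = C := by
    ext v
    simp only [mem_biUnion, id, hQ, mem_filter]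
    constructor
    · rintro ⟨D, ⟨-, h⟩, hv⟩; exact h hv
    · intro hv
      obtain ⟨D, hD, hvD⟩ := hP₀.exists_mem (hP.subset hC hv)
      refine ⟨D, ⟨hD, (hsub D hD).resolve_right fun h => disjoint_left.1 h hvD hv⟩, hvD⟩
  have hcr : crossing p q P₀ F = crossing p q P₀ B₀ := by
    ext e
    rw [mem_crossing, mem_crossing]
    refine ⟨fun h => ⟨?_, h.2⟩, fun h => ⟨hB₀F h.1, h.2⟩⟩
    by_contra he
    obtain ⟨X, hX, hpX, hqX⟩ := hspan e h.1 he
    have hXV := hX.subset_of_mem hm hB₀ (fun e he => hF e (hB₀F he)) hpX (hF e h.1).1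
    obtain ⟨D, hD, hXD⟩ := hP₀.exists_superset X hX hXV
    exact h.2 D hD ⟨hXD hpX, hXD hqX⟩
  have hCV := hP.subset hC
  have h1 := hP₀.card_inside hQP
  rw [hQC] at h1
  have h2 := hB₀ C (hP.tight C hC).1
  have hdjQ : (Q : Set (Finset α)).PairwiseDisjoint id := hP₀.disjoint.subset (by simpa using hQP)
  have h3 := sum_between (p := p) (q := q) (X := crossing p q P₀ F) (R := V) hdjQ
  have hbd : ∀ D ∈ P₀, between p q (crossing p q P₀ F) D V = boundary p q F D :=
    fun D hD => hP₀.between_eq_boundary hF hD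
  have h4 : between p q (crossing p q P₀ F) C V =
      2 * #(links p q (crossing p q P₀ F) C C) + boundary p q F C := by
    have hV : V = C ∪ (V \ C) := by rw [union_sdiff_of_subset hCV]
    rw [boundary_eq_between (V := V) (P := P₀) hF hsub, ← between_self]
    conv_lhs => rw [hV]
    rw [between_union disjoint_sdiff]
  rw [sum_congr rfl fun D hD => hbd D (hQP hD), hQC, h4] at h3
  have hQne : 1 ≤ #Q := by
    rw [Nat.one_le_iff_ne_zero, Ne, card_eq_zero]
    intro h
    rw [h] at hQC
    simp only [biUnion_empty] at hQC
    exact (hP.tight C hC).1.ne_empty hQC.symm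
  have h5 : ∑ D ∈ Q, #D = #C := by rw [← hQC, card_biUnion hdjQ]; rfl
  have h6 := sum_le_sum fun D (hD : D ∈ Q) => hsize D (hP₀.maximal (hQP hD))
  rw [sum_sub_distrib, ← mul_sum, sum_const, nsmul_eq_mul, ← Nat.cast_sum, ← Nat.cast_sum, h3,
    h5] at h6
  rw [← hcr] at h1
  have hm' : (0 : ℝ) < m := by exact_mod_cast hm
  -- The edges joining members of `Q` are counted twice in the sum of their boundaries, but sparsity
  -- of `B₀` on `C` allows at most `m (|Q| - 1)` of them. This absorbs all but one of the `|Q|`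
  -- terms `c - 1`.
  have h7 : #(links p q (crossing p q P₀ F) C C) + m ≤ m * #Q := by omega
  have h8 : (#(links p q (crossing p q P₀ F) C C) : ℝ) + m ≤ m * #Q := by exact_mod_cast h7
  have h9 : (#(links p q (crossing p q P₀ F) C C) : ℝ) / m ≤ #Q - 1 := by
    rw [div_le_iff₀ hm']; linarith
  have hQ1 : (1 : ℝ) ≤ #Q := by exact_mod_cast hQne
  push_cast at h6
  have h10 : (c - 1) / (2 * (m : ℝ)) * (2 * #(links p q (crossing p q P₀ F) C C) +
      boundary p q F C) = (c - 1) * (#(links p q (crossing p q P₀ F) C C) / m) +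
        (c - 1) * (boundary p q F C / (2 * m)) := by
    field_simp
  rw [h10] at h6
  nlinarith [mul_le_mul_of_nonneg_left h9 (sub_nonneg.2 hc)]

end EdgeSparse

/-! ### Weight bound from a maximal independent set -/

namespace EdgeSparse

open Finset

variable {α β : Type*} [DecidableEq α] [DecidableEq β]
variable {p q : β → α} {X : Finset β} {W W₁ Z : Finset α} {Q : Finset (Finset α)}

/-- A maximal independent set of `W` that extends a maximal independent set of `W₁`. -/
lemma exists_maximal_independent (hX : ∀ e ∈ X, p e ≠ q e) (hW₁ : W₁ ⊆ W) :
    ∃ K ⊆ W, (∀ e ∈ X, ¬ (p e ∈ K ∧ q e ∈ K)) ∧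
      (∀ v ∈ W, v ∉ K → ∃ e ∈ X, (p e = v ∧ q e ∈ K) ∨ (q e = v ∧ p e ∈ K)) ∧
      (∀ v ∈ W₁, v ∉ K → ∃ e ∈ X, (p e = v ∧ q e ∈ K ∩ W₁) ∨ (q e = v ∧ p e ∈ K ∩ W₁)) := by
  classical
  set ind : Finset α → Finset (Finset α) :=
    fun Y => Y.powerset.filter fun K => ∀ e ∈ X, ¬ (p e ∈ K ∧ q e ∈ K) with hind
  have key : ∀ Y K, Maximal (· ∈ ind Y) K → ∀ v ∈ Y, v ∉ K →
      ∃ e ∈ X, (p e = v ∧ q e ∈ K) ∨ (q e = v ∧ p e ∈ K) := by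
    intro Y K hK v hv hvK
    have hK' := mem_filter.1 hK.prop
    by_contra! hno
    refine hvK (hK.le_of_ge (y := insert v K) (mem_filter.2 ⟨mem_powerset.2
      (insert_subset hv (mem_powerset.1 hK'.1)), fun e he => ?_⟩) (subset_insert _ _)
      (mem_insert_self _ _))
    rintro ⟨h1, h2⟩
    have h3 := hno e he
    have h4 := hK'.2 e he
    have h5 := hX e he
    rw [mem_insert] at h1 h2
    rcases h1 with h1 | h1 <;> rcases h2 with h2 | h2
    · exact h5 (h1.trans h2.symm)
    · exact h3.1 h1 h2
    · exact h3.2 h2 h1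
    · exact h4 ⟨h1, h2⟩
  -- Choosing the part in `W₁` first ensures that the rest of `W₁` is dominated from within `W₁`.
  obtain ⟨K₁, -, hK₁⟩ := (ind W₁).exists_le_maximal (a := ∅) (by simp [hind])
  have hK₁' := mem_filter.1 hK₁.prop
  obtain ⟨K, hK₁K, hK⟩ := (ind W).exists_le_maximal (a := K₁) (mem_filter.2
    ⟨mem_powerset.2 ((mem_powerset.1 hK₁'.1).trans hW₁), hK₁'.2⟩)
  have hK' := mem_filter.1 hK.prop
  refine ⟨K, mem_powerset.1 hK'.1, hK'.2, key W K hK, fun v hv hvK => ?_⟩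
  obtain ⟨e, he, h⟩ := key W₁ K₁ hK₁ v hv (fun h => hvK (hK₁K h))
  have hsub : K₁ ⊆ K ∩ W₁ := subset_inter hK₁K (mem_powerset.1 hK₁'.1)
  exact ⟨e, he, h.imp (fun h => ⟨h.1, hsub h.2⟩) (fun h => ⟨h.1, hsub h.2⟩)⟩

lemma sum_card_inter (hQ : (Q : Set (Finset α)).PairwiseDisjoint id) (hZ : Z ⊆ Q.biUnion id) :
    ∑ C ∈ Q, #(C ∩ Z) = #Z := by
  have h : Q.biUnion (fun C => C ∩ Z) = Z := by
    ext v
    have := @hZ v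
    simp only [mem_biUnion, mem_inter, id] at this ⊢
    grind
  rw [← card_biUnion, h]
  exact fun C hC D hD hne => (hQ hC hD hne).mono inter_subset_left inter_subset_left

/-- Bound for a sum of weights over a disjoint family `Q` covering `W`. A maximal independent set
`K` of `W` separates the members that it meets; the members that it misses are paid for by the
edges that join them to `K`. -/
lemma sum_weight_le {φ : Finset α → ℝ} {t μ n : ℝ} {V₁ : Finset α}
    (hX : ∀ e ∈ X, p e ≠ q e) (hQ : (Q : Set (Finset α)).PairwiseDisjoint id)
    (hW : W ⊆ Q.biUnion id) (hμ : t ≤ μ) (hμ₀ : 0 ≤ μ)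
    (htough : ∀ K ⊆ W, (∀ e ∈ X, ¬ (p e ∈ K ∧ q e ∈ K)) →
      (#(Q.filter fun C => (C ∩ K).Nonempty) : ℝ) ≤ t * (n - #K) + 1)
    (hkept : ∀ C ∈ Q, φ C ≤ 1 - between p q X C W * μ)
    (heaten : ∀ C ∈ Q, #(C ∩ W) ≤ between p q X C W →
      (C ⊆ V₁ → #(C ∩ W) ≤ between p q X C V₁) → φ C ≤ (μ - t) * #(C ∩ W)) :
    ∑ C ∈ Q, φ C ≤ t * (n - #W) + 1 := by
  obtain ⟨K, hKW, hind, hdom, hdom₁⟩ := exists_maximal_independent hX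
    (inter_subset_left (s₁ := W) (s₂ := V₁))
  set kept := Q.filter fun C => (C ∩ K).Nonempty with hkeptdef
  have hkQ : kept ⊆ Q := filter_subset _ _
  have hk := htough K hKW hind
  have hterm : ∀ C ∈ Q, φ C + t * #(C ∩ W) ≤
      (if (C ∩ K).Nonempty then 1 - between p q X C W * μ else 0) + t * #(C ∩ K) +
        μ * #(C ∩ (W \ K)) := by
    intro C hC
    split_ifs with hCK
    · have h1 : #(C ∩ K) + #(C ∩ (W \ K)) = #(C ∩ W) := by
        rw [← card_union_of_disjoint, ← inter_union_distrib_left, union_sdiff_of_subset hKW]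
        exact disjoint_sdiff.mono inter_subset_right inter_subset_right
      have h2 : (#(C ∩ W) : ℝ) = #(C ∩ K) + #(C ∩ (W \ K)) := by exact_mod_cast h1.symm
      have h3 := hkept C hC
      have h4 : t * (#(C ∩ (W \ K)) : ℝ) ≤ μ * #(C ∩ (W \ K)) :=
        mul_le_mul_of_nonneg_right hμ (Nat.cast_nonneg _)
      rw [h2]
      linarith
    -- If `K` misses `C`, every vertex of `C ∩ W` sends an edge to `K`, which is what `heaten`
    -- requires.
    · rw [not_nonempty_iff_eq_empty] at hCK
      have hdj : ∀ v, v ∈ C → v ∉ K := fun v hv hvK => by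
        have : v ∈ C ∩ K := mem_inter.2 ⟨hv, hvK⟩
        simp [hCK] at this
      have h1 : C ∩ (W \ K) = C ∩ W := by
        ext v
        have := hdj v
        simp only [mem_inter, mem_sdiff]
        tauto
      have h2 : #(C ∩ W) ≤ between p q X (C ∩ W) K :=
        card_le_between (disjoint_left.2 fun v hv => hdj v (mem_inter.1 hv).1)
          fun v hv => hdom v (mem_inter.1 hv).2 (hdj v (mem_inter.1 hv).1)
      have h3 : C ⊆ V₁ → #(C ∩ W) ≤ between p q X C V₁ := by
        intro hCV
        have h4 : #(C ∩ W) ≤ between p q X (C ∩ W) (K ∩ (W ∩ V₁)) :=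
          card_le_between (disjoint_left.2 fun v hv hv' =>
            hdj v (mem_inter.1 hv).1 (mem_inter.1 hv').1)
            fun v hv => hdom₁ v (mem_inter.2 ⟨(mem_inter.1 hv).2, hCV (mem_inter.1 hv).1⟩)
              (hdj v (mem_inter.1 hv).1)
        exact h4.trans (between_mono inter_subset_left
          (inter_subset_right.trans inter_subset_right))
      have h5 := heaten C hC (h2.trans (between_mono inter_subset_left hKW)) h3
      rw [h1, hCK]
      simp only [card_empty, Nat.cast_zero]
      linarith
  have hsum := sum_le_sum hterm
  simp only [sum_add_distrib, ← mul_sum] at hsum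
  rw [← sum_filter, ← hkeptdef, sum_sub_distrib, ← sum_mul, sum_const, nsmul_eq_mul, mul_one] at hsum
  simp only [← Nat.cast_sum] at hsum
  rw [sum_card_inter hQ hW, sum_card_inter hQ (hKW.trans hW),
    sum_card_inter hQ (sdiff_subset.trans hW),
    sum_between (hQ.subset (coe_subset.2 hkQ))] at hsum
  -- Each vertex of `W \ K` is joined to `K`, which lies in the kept members. The degree terms of
  -- the kept members therefore pay for all of `W \ K`.
  have hrem : #(W \ K) ≤ between p q X (kept.biUnion id) W := by
    refine (card_le_between (X := X) (p := p) (q := q) (R := K) sdiff_disjoint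
      fun v hv => hdom v (mem_sdiff.1 hv).1 (mem_sdiff.1 hv).2).trans ?_
    rw [between_comm]
    refine between_mono (fun v hv => ?_) sdiff_subset
    obtain ⟨C, hC, hvC⟩ := mem_biUnion.1 (hW (hKW hv))
    exact mem_biUnion.2 ⟨C, mem_filter.2 ⟨hC, v, mem_inter.2 ⟨hvC, hv⟩⟩, hvC⟩
  have hrem' : μ * (#(W \ K) : ℝ) ≤ between p q X (kept.biUnion id) W * μ := by
    rw [mul_comm]
    exact mul_le_mul_of_nonneg_right (by exact_mod_cast hrem) hμ₀
  linarith

end EdgeSparse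

/-! ### Counting matching ends and weighing the partition -/

namespace EdgeSparse

open Finset

variable {α β : Type*} [DecidableEq α] [DecidableEq β]
variable {p q : β → α} {m : ℕ} {A B N M X : Finset β} {V W S : Finset α} {u : α}
  {P : Finset (Finset α)}

lemma Feasible.two_mul_card_inside_le (hM : Feasible p q m B N u M) :
    2 * #(inside p q M S) ≤ #(S.erase u) := by
  have hp : Set.InjOn p (inside p q M S : Set β) := fun e he f hf h =>
    hM.eq_of_inc e (inside_subset he) f (inside_subset hf) (p f) (.inl h) (.inl rfl)
  have hq : Set.InjOn q (inside p q M S : Set β) := fun e he f hf h =>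
    hM.eq_of_inc e (inside_subset he) f (inside_subset hf) (q f) (.inr h) (.inr rfl)
  have hd : Disjoint ((inside p q M S).image p) ((inside p q M S).image q) := by
    rw [disjoint_left]
    intro v h1 h2
    obtain ⟨e, he, rfl⟩ := mem_image.1 h1
    obtain ⟨f, hf, h⟩ := mem_image.1 h2
    have hef := hM.eq_of_inc e (inside_subset he) f (inside_subset hf) (p e) (.inl rfl) (.inr h)
    subst hef
    exact hM.sparse.ne (mem_union_right _ (inside_subset he)) h.symm
  have h1 : (inside p q M S).image p ∪ (inside p q M S).image q ⊆ S.erase u := by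
    intro v hv
    rcases mem_union.1 hv with hv | hv <;> obtain ⟨e, he, rfl⟩ := mem_image.1 hv
    · exact mem_erase.2 ⟨fun h => hM.not_inc e (inside_subset he) (.inl h), (mem_inside.1 he).2.1⟩
    · exact mem_erase.2 ⟨fun h => hM.not_inc e (inside_subset he) (.inr h), (mem_inside.1 he).2.2⟩
  have h2 := card_le_card h1
  rw [card_union_of_disjoint hd, card_image_of_injOn hp, card_image_of_injOn hq] at h2
  omega

/-- If `M` covers `S \ {u}`, then counting the ends of `M` in `S` bounds `|M|` from below. -/
lemma card_erase_add_card_inside_le (hV : ∀ e ∈ M, p e ∈ V ∧ q e ∈ V) (hVW : V = W ∪ S)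
    (hWS : Disjoint W S) (hcov : ∀ v ∈ S, v ≠ u → ∃ e ∈ M, Inc p q e v) :
    #(inside p q M W) + #(S.erase u) ≤ #M + #(inside p q M S) := by
  have h1 : #(S.erase u) ≤ between p q M S V := by
    have hinj : Set.InjOn (fun v : α => ({v} : Finset α)) (S.erase u : Set α) :=
      fun v _ w _ h => singleton_injective h
    have hdj : (((S.erase u).image fun v : α => ({v} : Finset α) : Finset (Finset α)) :
        Set (Finset α)).PairwiseDisjoint id := by
      intro C hC D hD hne
      obtain ⟨v, -, rfl⟩ := mem_image.1 (mem_coe.1 hC)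
      obtain ⟨w, -, rfl⟩ := mem_image.1 (mem_coe.1 hD)
      simpa [Function.onFun] using fun h : v = w => hne (by rw [h])
    have h2 := sum_between (p := p) (q := q) (X := M) (R := V) hdj
    rw [sum_image hinj] at h2
    have h3 : ∀ v ∈ S.erase u, 1 ≤ between p q M {v} V := by
      intro v hv
      rw [mem_erase] at hv
      obtain ⟨e, he, h⟩ := hcov v hv.2 hv.1
      rw [between]
      rcases h with h | h
      · have : 0 < #(links p q M {v} V) :=
          card_pos.2 ⟨e, mem_links.2 ⟨he, by simp [h], (hV e he).2⟩⟩
        omega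
      · have : 0 < #(links p q M V {v}) :=
          card_pos.2 ⟨e, mem_links.2 ⟨he, (hV e he).1, by simp [h]⟩⟩
        omega
    have h4 := sum_le_sum h3
    rw [sum_const, smul_eq_mul, mul_one, h2] at h4
    refine h4.trans (between_mono (fun v hv => ?_) Subset.rfl)
    simp only [mem_biUnion, mem_image, id] at hv
    obtain ⟨C, ⟨w, hw, rfl⟩, hv⟩ := hv
    rw [mem_singleton] at hv
    exact mem_of_mem_erase (hv ▸ hw)
  have h2 : between p q M V V = 2 * #M := by
    rw [between_self]
    congr 2
    ext e
    have := hV e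
    rw [mem_links]
    tauto
  have h3 : between p q M S V = between p q M S W + between p q M S S := by
    rw [hVW, between_union hWS]
  have h4 : between p q M V V = between p q M V W + between p q M V S := by
    conv_lhs => rw [hVW]
    rw [between_union hWS, ← hVW]
  have h5 : between p q M V W = between p q M W W + between p q M W S := by
    rw [between_comm, hVW, between_union hWS]
  rw [between_comm (S := V) (R := S), h3] at h4
  rw [h3] at h1
  have h6 : between p q M W W = 2 * #(inside p q M W) := between_self
  have h7 : between p q M S S = 2 * #(inside p q M S) := between_self
  rw [h5, between_comm (S := W) (R := S)] at h4
  omega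

/-- The members of the partition outside `W` and the remaining ones, weighted by their degrees. -/
lemma weight_le {c : ℝ} (hm : 1 ≤ m) (hc : 2 * (m : ℝ) + 1 ≤ c)
    (hP : IsTightPartition p q m A V P) (hX : ∀ e ∈ X, p e ≠ q e)
    (hXP : ∀ e ∈ X, p e ∈ V ∧ q e ∈ V) (hVW : V = W ∪ S) (hWS : Disjoint W S)
    (hsize : ∀ C ∈ P, (c - 1) * (1 - (between p q X C V : ℝ) / (2 * m)) ≤ #C - 1)
    (htough : ∀ K ⊆ W, (∀ e ∈ X, ¬ (p e ∈ K ∧ q e ∈ K)) →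
      (#(P.filter fun C => (C ∩ K).Nonempty) : ℝ) ≤
        (c - 2 * m) / (2 * m * (c - 1)) * (#V - #K) + 1) :
    (c - 1) * (m * #P - #X) + (m * #(P.filter fun C => ¬ C ⊆ W) -
      #(links p q X ((P.filter fun C => ¬ C ⊆ W).biUnion id)
        ((P.filter fun C => ¬ C ⊆ W).biUnion id))) ≤ c / 2 * #S + m * (c - 1) := by
  set Q := P.filter fun C => ¬ C ⊆ W with hQ
  set PY := P.filter fun C => C ⊆ W with hPY
  set PS := Q.filter fun C => Disjoint C W with hPS
  set PX := Q.filter fun C => ¬ Disjoint C W with hPX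
  set VQ := Q.biUnion id with hVQ
  set VY := PY.biUnion id with hVY
  set VS := PS.biUnion id with hVS
  set VX := PX.biUnion id with hVX
  have hQP : Q ⊆ P := filter_subset _ _
  have hYP : PY ⊆ P := filter_subset _ _
  have hSQ : PS ⊆ Q := filter_subset _ _
  have hXQ : PX ⊆ Q := filter_subset _ _
  have hdjP := hP.disjoint
  have hdj : ∀ R ⊆ P, (R : Set (Finset α)).PairwiseDisjoint id := fun R hR =>
    hdjP.subset (coe_subset.2 hR)
  have hPQY : Q ∪ PY = P := by
    rw [union_comm]; exact filter_union_filter_not_eq _ P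
  have hdQY : Disjoint Q PY := (disjoint_filter_filter_not P P _).symm
  have hQSX : PS ∪ PX = Q := filter_union_filter_not_eq _ Q
  have hdSX : Disjoint PS PX := disjoint_filter_filter_not Q Q _
  have hdV : ∀ R ⊆ P, ∀ R' ⊆ P, Disjoint R R' → Disjoint (R.biUnion id) (R'.biUnion id) := by
    intro R hR R' hR' h
    rw [disjoint_biUnion_left]
    intro C hC
    rw [disjoint_biUnion_right]
    exact fun D hD => hdjP (hR hC) (hR' hD) (fun h' => disjoint_left.1 h hC (h' ▸ hD))
  have hV : V = VQ ∪ VY := by rw [hVQ, hVY, ← union_biUnion, hPQY, hP.biUnion]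
  have hVQ' : VQ = VS ∪ VX := by rw [hVS, hVX, ← union_biUnion, hQSX]
  have hdVQY : Disjoint VQ VY := hdV Q hQP PY hYP hdQY
  have hdVSX : Disjoint VS VX := hdV PS (hSQ.trans hQP) PX (hXQ.trans hQP) hdSX
  have hbV : ∀ C, between p q X C V = between p q X C VQ + between p q X C VY := fun C => by
    rw [hV, between_union hdVQY]
  have hbQ : ∀ C, between p q X C VQ = between p q X C VS + between p q X C VX := fun C => by
    rw [hVQ', between_union hdVSX]
  have hm' : (1 : ℝ) ≤ m := by exact_mod_cast hm
  have hc1 : 0 < c - 1 := by linarith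
  obtain ⟨μ, hμ⟩ : ∃ μ : ℝ, μ = 1 / (2 * m) := ⟨_, rfl⟩
  have hμ₀ : 0 < μ := by rw [hμ]; positivity
  have hμm : 2 * m * μ = 1 := by rw [hμ]; field_simp
  have hμ1 : μ ≤ 1 / 2 := by nlinarith
  obtain ⟨t, ht⟩ : ∃ t : ℝ, t = (c - 2 * m) / (2 * m * (c - 1)) := ⟨_, rfl⟩
  have htc : (c - 1) * t = c * μ - 1 := by
    rw [ht, hμ]; field_simp
  have htμ : (c - 1) * (μ - t) = 1 - μ := by rw [mul_sub, htc]; ring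
  set w : Finset α → ℝ := fun C => 1 - between p q X C V * μ with hw
  have hsize' : ∀ C ∈ P, (c - 1) * w C ≤ #C - 1 := by
    intro C hC
    have := hsize C hC
    rw [div_eq_mul_one_div, ← hμ] at this
    exact this
  -- After multiplication by `c - 1`, a mixed member carries its second weight, coming from `Q`,
  -- minus its share of `|S|`. A member inside `W` carries the cost `μ` of each edge to the members
  -- inside `S`, a cost that `hcross` cancels.
  set φ : Finset α → ℝ := fun C => if C ⊆ W then w C + between p q X C VS * μ / (c - 1)
    else w C + (1 - between p q X C VQ * μ - #(C ∩ S)) / (c - 1) with hφ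
  have hφY : ∀ C ∈ PY, (c - 1) * φ C = (c - 1) * w C + between p q X C VS * μ := by
    intro C hC
    simp only [hφ, if_pos (mem_filter.1 hC).2]
    field_simp
  have hφX : ∀ C ∈ PX, (c - 1) * φ C =
      (c - 1) * w C + (1 - between p q X C VQ * μ - #(C ∩ S)) := by
    intro C hC
    simp only [hφ, if_neg (mem_filter.1 (hXQ hC)).2]
    field_simp
  have hXS : ∀ C ∈ Q, (1 : ℝ) ≤ #(C ∩ S) := by
    intro C hC
    have hC' := mem_filter.1 hC
    obtain ⟨v, hv, hvW⟩ := not_subset.1 hC'.2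
    have hvV := hP.subset hC'.1 hv
    rw [hVW, mem_union] at hvV
    have : 0 < #(C ∩ S) := card_pos.2 ⟨v, mem_inter.2 ⟨hv, hvV.resolve_left hvW⟩⟩
    exact_mod_cast this
  have hcardC : ∀ C ∈ P, (#C : ℝ) = #(C ∩ W) + #(C ∩ S) := by
    intro C hC
    have : #C = #(C ∩ W) + #(C ∩ S) := by
      rw [← card_union_of_disjoint (hWS.mono inter_subset_right inter_subset_right),
        ← inter_union_distrib_left, ← hVW, inter_eq_left.2 (hP.subset hC)]
    exact_mod_cast this
  -- the weights of the members that meet `W`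
  have hdYX : Disjoint PX PY := hdQY.mono_left hXQ
  have hWsub : W ⊆ (PX ∪ PY).biUnion id := by
    intro v hv
    obtain ⟨C, hC, hvC⟩ := hP.exists_mem (show v ∈ V by rw [hVW]; exact mem_union_left _ hv)
    refine mem_biUnion.2 ⟨C, mem_union.2 ?_, hvC⟩
    by_cases h : C ⊆ W
    · exact .inr (mem_filter.2 ⟨hC, h⟩)
    · exact .inl (mem_filter.2 ⟨mem_filter.2 ⟨hC, h⟩, fun h => disjoint_left.1 h hvC hv⟩)
  have hWXY : W ⊆ VX ∪ VY := by rw [hVX, hVY, ← union_biUnion]; exact hWsub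
  have hbW : ∀ C, between p q X C W ≤ between p q X C VX + between p q X C VY := by
    intro C
    rw [← between_union (hdVQY.mono_left (hVQ' ▸ subset_union_right))]
    exact between_mono Subset.rfl hWXY
  have hXYP : PX ∪ PY ⊆ P := union_subset (hXQ.trans hQP) hYP
  -- The choice `V₁ = VX` matters for mixed members missed by `K`: their dominating edges must stay
  -- in `VQ`, since only those reduce the second weight.
  have hgreedy : ∑ C ∈ PX ∪ PY, φ C ≤ t * (#V - #W) + 1 := by
    refine sum_weight_le (X := X) (p := p) (q := q) (μ := μ) (V₁ := VX) hX (hdj _ hXYP) hWsub ?_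
      hμ₀.le ?_ ?_ ?_
    · have : 0 ≤ (c - 1) * (μ - t) := by rw [htμ]; linarith
      nlinarith
    · intro K hK hind
      refine le_trans ?_ (ht ▸ htough K hK hind)
      exact_mod_cast card_le_card (filter_subset_filter _ hXYP)
    · intro C hC
      have hb := hbW C
      have h1 := hbV C
      have h2 := hbQ C
      rcases mem_union.1 hC with hC | hC
      · have h3 := hφX C hC
        have h4 := hXS C (hXQ hC)
        have h5 : (between p q X C W : ℝ) ≤ between p q X C V := by
          exact_mod_cast hb.trans (by omega)
        have h6 : φ C ≤ w C := by
          have : (0 : ℝ) ≤ between p q X C VQ * μ := by positivity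
          nlinarith
        have : (between p q X C W : ℝ) * μ ≤ between p q X C V * μ :=
          mul_le_mul_of_nonneg_right h5 hμ₀.le
        simp only [hw] at h6
        linarith
      · have h3 := hφY C hC
        have h5 : (between p q X C W : ℝ) + between p q X C VS ≤ between p q X C V := by
          exact_mod_cast (show _ by omega)
        have h6 : φ C ≤ w C + between p q X C VS * μ := by
          have : (0 : ℝ) ≤ between p q X C VS * μ := by positivity
          have : 0 ≤ (c - 2) * (between p q X C VS * μ) := mul_nonneg (by linarith) this
          nlinarith
        have : ((between p q X C W : ℝ) + between p q X C VS) * μ ≤ between p q X C V * μ :=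
          mul_le_mul_of_nonneg_right h5 hμ₀.le
        simp only [hw] at h6
        linarith
    · intro C hC he heX
      have h1 := hbV C
      have h2 := hbQ C
      have hC1 := hcardC C (hXYP hC)
      have h7 := hsize' C (hXYP hC)
      suffices h : (c - 1) * φ C ≤ (1 - μ) * #(C ∩ W) by
        rw [← htμ] at h
        have h' : (c - 1) * φ C ≤ (c - 1) * ((μ - t) * #(C ∩ W)) := by linarith
        exact le_of_mul_le_mul_left h' hc1
      rcases mem_union.1 hC with hC | hC
      · rw [hφX C hC]
        have h3 := heX (by rw [hVX]; exact subset_biUnion_of_mem id hC)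
        have h4 : (#(C ∩ W) : ℝ) ≤ between p q X C VQ := by exact_mod_cast h3.trans (by omega)
        have h5 := mul_le_mul_of_nonneg_right h4 hμ₀.le
        linarith
      · rw [hφY C hC]
        have hCW : C ∩ W = C := inter_eq_left.2 (mem_filter.1 hC).2
        rw [hCW] at he ⊢
        have h3 : (#C : ℝ) + between p q X C VS ≤ between p q X C V := by
          have := hbW C
          exact_mod_cast (show _ by omega)
        have h4 := mul_le_mul_of_nonneg_right h3 hμ₀.le
        have h5 : between p q X C V * μ = 1 - w C := by simp only [hw]; ring
        rw [h5] at h4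
        have h6 : (1 : ℝ) ≤ #C := by exact_mod_cast (hP.tight C (hYP hC)).1.card_pos
        rcases le_or_gt 0 (w C) with h0 | h0
        · linarith
        · have : (c - 2) * w C ≤ 0 := mul_nonpos_of_nonneg_of_nonpos (by linarith) h0.le
          linarith
  -- the members outside `W`
  have hPSle : ∀ C ∈ PS, (c - 1) * w C + (1 - between p q X C VQ * μ) ≤
      #(C ∩ S) + between p q X C VY * μ := by
    intro C hC
    have hCP := hQP (hSQ hC)
    have h1 := hsize' C hCP
    have h2 := hcardC C hCP
    rw [disjoint_iff_inter_eq_empty.1 (mem_filter.1 hC).2] at h2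
    simp only [card_empty, Nat.cast_zero, zero_add] at h2
    have h3 : (between p q X C V : ℝ) = between p q X C VQ + between p q X C VY := by
      exact_mod_cast hbV C
    have h4 : w C = 1 - (between p q X C VQ + between p q X C VY) * μ := by simp only [hw, h3]
    have h5 : w C ≤ 1 := by
      have : 0 ≤ (between p q X C V : ℝ) * μ := by positivity
      simp only [hw]; linarith
    linarith
  have hsumS := sum_le_sum hPSle
  have hsumX : ∑ C ∈ PX, ((c - 1) * w C + (1 - between p q X C VQ * μ)) =
      ∑ C ∈ PX, ((c - 1) * φ C + #(C ∩ S)) :=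
    sum_congr rfl fun C hC => by rw [hφX C hC]; ring
  have hsumY : ∑ C ∈ PY, (c - 1) * w C = ∑ C ∈ PY, ((c - 1) * φ C - between p q X C VS * μ) :=
    sum_congr rfl fun C hC => by rw [hφY C hC]; ring
  have hcross : ∑ C ∈ PS, (between p q X C VY : ℝ) * μ = ∑ C ∈ PY, between p q X C VS * μ := by
    rw [← sum_mul, ← sum_mul, ← Nat.cast_sum, ← Nat.cast_sum, sum_between (hdj _ (hSQ.trans hQP)),
      sum_between (hdj _ hYP), between_comm]
  have hsumP : ∑ C ∈ P, w C = #P - 2 * #X * μ := by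
    have h : between p q X V V = 2 * #X := by
      rw [between_self]
      congr 2
      ext e
      have := hXP e
      rw [mem_links]
      tauto
    simp only [hw]
    rw [sum_sub_distrib, ← sum_mul, ← Nat.cast_sum, sum_between hdjP, hP.biUnion, h]
    simp
  have hsumQ : ∑ C ∈ Q, (1 - between p q X C VQ * μ) = #Q - 2 * #(links p q X VQ VQ) * μ := by
    rw [sum_sub_distrib, ← sum_mul, ← Nat.cast_sum, sum_between (hdj _ hQP), ← hVQ, between_self]
    simp
  have hSsub : S ⊆ Q.biUnion id := by
    intro v hv
    obtain ⟨C, hC, hvC⟩ := hP.exists_mem (show v ∈ V by rw [hVW]; exact mem_union_right _ hv)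
    exact mem_biUnion.2 ⟨C, mem_filter.2 ⟨hC, fun h => disjoint_left.1 hWS (h hvC) hv⟩, hvC⟩
  have hsumCS : ∑ C ∈ PS, (#(C ∩ S) : ℝ) + ∑ C ∈ PX, (#(C ∩ S) : ℝ) = #S := by
    rw [← sum_union hdSX, hQSX]
    exact_mod_cast sum_card_inter (hdj _ hQP) hSsub
  have hP1 : ∑ C ∈ P, w C = ∑ C ∈ PS, w C + ∑ C ∈ PX, w C + ∑ C ∈ PY, w C := by
    rw [← sum_union hdSX, hQSX, ← sum_union hdQY, hPQY]
  have hQ1 : ∑ C ∈ Q, (1 - (between p q X C VQ : ℝ) * μ) =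
      ∑ C ∈ PS, (1 - (between p q X C VQ : ℝ) * μ) +
        ∑ C ∈ PX, (1 - (between p q X C VQ : ℝ) * μ) := by
    rw [← sum_union hdSX, hQSX]
  rw [sum_union hdYX] at hgreedy
  simp only [sum_add_distrib, ← mul_sum] at hsumS hsumX
  rw [sum_sub_distrib, ← mul_sum, ← mul_sum] at hsumY
  have hVcard : (#V : ℝ) = #W + #S := by
    have : #V = #W + #S := by rw [hVW, card_union_of_disjoint hWS]
    exact_mod_cast this
  -- The shares of `S` add up to `|S|`, the cross terms cancel, and the weights `φ` contribute `(c -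
  -- 1) (t |S| + 1)`. The stated bound is this one times `m`.
  have hmain : (c - 1) * (#P - 2 * #X * μ) + (#Q - 2 * #(links p q X VQ VQ) * μ) ≤
      #S + (c * μ - 1) * #S + (c - 1) := by
    rw [← hsumP, ← hsumQ, hP1, hQ1, ← htc]
    have h1 := mul_le_mul_of_nonneg_left hgreedy hc1.le
    rw [hVcard] at h1
    linarith
  have h2 := mul_le_mul_of_nonneg_left hmain (show (0 : ℝ) ≤ m by linarith)
  have e1 : (m : ℝ) * ((c - 1) * (#P - 2 * #X * μ) + (#Q - 2 * #(links p q X VQ VQ) * μ)) =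
      (c - 1) * (m * #P - #X * (2 * m * μ)) + (m * #Q - #(links p q X VQ VQ) * (2 * m * μ)) := by
    ring
  have e2 : (m : ℝ) * (#S + (c * μ - 1) * #S + (c - 1)) =
      c / 2 * #S * (2 * m * μ) + m * (c - 1) := by ring
  rw [e1, e2, hμm] at h2
  linarith

end EdgeSparse

/-! ### Completing the sparse set by a matching -/

namespace EdgeSparse

open Finset

variable {α β : Type*} [DecidableEq α] [DecidableEq β]
variable {p q : β → α} {m : ℕ} {F N B₀ : Finset β} {V : Finset α} {u : α}

/-- In a sufficiently tough graph whose tree components are sufficiently large, the sparse set `B₀`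
that spans `F` can be completed to a basis by a matching that avoids `u`. -/
theorem exists_matching_basis {c : ℝ} (hm : 1 ≤ m) (hc : 2 * (m : ℝ) + 1 ≤ c)
    (hF : ∀ e ∈ F, p e ∈ V ∧ q e ∈ V) (hN : ∀ e ∈ N, p e ∈ V ∧ q e ∈ V) (hFN : Disjoint F N)
    (hB₀ : Sparse p q m B₀) (hB₀F : B₀ ⊆ F)
    (hspan : ∀ e ∈ F, e ∉ B₀ → ∃ X, Tight p q m B₀ X ∧ p e ∈ X ∧ q e ∈ X)
    (hsize : ∀ X, Maximal (fun T => Tight p q m B₀ T ∧ T ⊆ V) X →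
      c - (c - 1) / (2 * (m : ℝ)) * (boundary p q F X : ℝ) ≤ (#X : ℝ))
    (htough : ∀ K ⊆ V, ∀ r : α → Finset α,
      (∀ e ∈ F ∪ N, p e ∈ K → q e ∈ K → r (p e) = r (q e)) →
      (#(K.image r) : ℝ) ≤ (c - 2 * m) / (2 * m * (c - 1)) * #(V \ K) + 1)
    (hu : u ∈ V) :
    ∃ M, Feasible p q m B₀ N u M ∧ #(B₀ ∪ M) + m = m * #V := by
  classical
  have hBN : Disjoint B₀ N := hFN.mono_left hB₀F
  obtain ⟨M, hMmem, hMmax⟩ := exists_max_image (N.powerset.filter fun M => Feasible p q m B₀ N u M)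
    (fun M => #M) ⟨∅, mem_filter.2 ⟨by simp, ⟨by simp, by simp, by simp, by simpa using hB₀⟩⟩⟩
  have hM := (mem_filter.1 hMmem).2
  have hmax : ∀ M', Feasible p q m B₀ N u M' → #M' ≤ #M := fun M' hM' =>
    hMmax M' (mem_filter.2 ⟨mem_powerset.2 hM'.subset, hM'⟩)
  refine ⟨M, hM, ?_⟩
  obtain ⟨W, hWV, huW, hcov, hWN⟩ := hM.exists_freeable hBN hN hmax
  set A := B₀ ∪ inside p q M W with hAdef
  have hAB : A ⊆ B₀ ∪ M := union_subset_union_right inside_subset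
  have hA := hM.sparse.mono hAB
  have hB₀A : B₀ ⊆ A := subset_union_left
  have hAV : ∀ e ∈ A, p e ∈ V ∧ q e ∈ V := by
    intro e he
    rcases mem_union.1 he with he | he
    · exact hF e (hB₀F he)
    · exact hN e (hM.subset (inside_subset he))
  obtain ⟨P, hP⟩ := exists_isTightPartition hA V
  have hpart : ∀ T, Tight p q m A T → ∀ v ∈ T, v ∈ V → ∃ C ∈ P, T ⊆ C := fun T hT v hvT hvV =>
    hP.exists_superset T hT (hT.subset_of_mem hm hA hAV hvT hvV)
  -- An edge of `F` outside `B₀` and a matching edge inside `W` both lie in tight sets of `A`, so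
  -- all crossing edges on either side come from `B₀`.
  have hcr : crossing p q P F = crossing p q P A := by
    ext e
    rw [mem_crossing, mem_crossing]
    refine and_congr_left fun h => ⟨fun he => ?_, fun he => ?_⟩
    · by_contra heA
      obtain ⟨X, hX, hpX, hqX⟩ := hspan e he fun h => heA (hB₀A h)
      obtain ⟨C, hC, hXC⟩ := hpart X (hX.mono hB₀A hA) _ hpX (hF e he).1
      exact h C hC ⟨hXC hpX, hXC hqX⟩
    · rcases mem_union.1 he with he | he
      · exact hB₀F he
      · rw [mem_inside] at he
        obtain ⟨X, hX, hpX, hqX⟩ := hWN e (hM.subset he.1) he.2.1 he.2.2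
        obtain ⟨C, hC, hXC⟩ := hpart X hX _ hpX (hWV he.2.1)
        exact absurd ⟨hXC hpX, hXC hqX⟩ (h C hC)
  set X := crossing p q P A with hXdef
  set S := V \ W with hS
  have hVW : V = W ∪ S := by rw [hS, union_sdiff_of_subset hWV]
  have hWS : Disjoint W S := disjoint_sdiff
  have hXV : ∀ e ∈ X, p e ∈ V ∧ q e ∈ V := fun e he => hAV e (mem_crossing.1 he).1
  have hXne : ∀ e ∈ X, p e ≠ q e := fun e he => hA.ne (mem_crossing.1 he).1
  have hw := weight_le hm hc hP hXne hXV hVW hWS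
    (fun C hC => by
      have h := le_card_of_tight hm (by linarith [(Nat.cast_nonneg m : (0 : ℝ) ≤ m)]) hF hB₀F hB₀A
        hA hspan hsize hP hC
      rwa [← hP.between_eq_boundary hF hC, hcr] at h)
    (fun K hK hind => by
      have hr : ∀ v, ∃ C, v ∈ V → C ∈ P ∧ v ∈ C := fun v => by
        by_cases hv : v ∈ V
        · obtain ⟨C, hC⟩ := hP.exists_mem hv
          exact ⟨C, fun _ => hC⟩
        · exact ⟨∅, fun h => absurd h hv⟩
      choose r hr using hr
      have hreq : ∀ C ∈ P, ∀ v ∈ C, r v = C := fun C hC v hv =>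
        hP.eq_of_mem (hr v (hP.subset hC hv)).1 hC (hr v (hP.subset hC hv)).2 hv
      -- Label each vertex by its member. Inside `K`, independence rules out crossing edges of `F`,
      -- and edges of `N` are spanned by tight sets, so labels are constant along edges.
      have h1 := htough K (hK.trans hWV) r fun e he hpK hqK => by
        by_contra hne
        have hnone : ∀ C ∈ P, ¬ (p e ∈ C ∧ q e ∈ C) := fun C hC h =>
          hne ((hreq C hC _ h.1).trans (hreq C hC _ h.2).symm)
        rcases mem_union.1 he with he | he
        · exact hind e (hcr ▸ mem_crossing.2 ⟨he, hnone⟩) ⟨hpK, hqK⟩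
        · obtain ⟨T, hT, hpT, hqT⟩ := hWN e he (hK hpK) (hK hqK)
          obtain ⟨C, hC, hTC⟩ := hpart T hT _ hpT (hWV (hK hpK))
          exact hnone C hC ⟨hTC hpT, hTC hqT⟩
      have h2 : (#(V \ K) : ℝ) = #V - #K := by
        rw [card_sdiff_of_subset (hK.trans hWV),
          Nat.cast_sub (card_le_card (hK.trans hWV))]
      rw [h2] at h1
      refine le_trans ?_ h1
      refine Nat.cast_le.2 (card_le_card fun C hC => ?_)
      obtain ⟨hCP, v, hv⟩ := mem_filter.1 hC
      rw [mem_inter] at hv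
      exact mem_image.2 ⟨v, hv.2, hreq C hCP v hv.1⟩)
  set Q := P.filter fun C => ¬ C ⊆ W with hQ
  have huS : u ∈ S := mem_sdiff.2 ⟨hu, huW⟩
  have hSQ : S ⊆ Q.biUnion id := by
    intro v hv
    obtain ⟨hvV, hvW⟩ := mem_sdiff.1 hv
    obtain ⟨C, hC, hvC⟩ := hP.exists_mem hvV
    exact mem_biUnion.2 ⟨C, mem_filter.2 ⟨hC, fun h => hvW (h hvC)⟩, hvC⟩
  have h1 := hP.card_inside Subset.rfl
  rw [hP.biUnion, ← hXdef] at h1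
  have hinA : inside p q A V = A := filter_true_of_mem hAV
  have hinX : links p q X V V = X := filter_true_of_mem hXV
  have hBM : Disjoint B₀ M := hBN.mono_right hM.subset
  have hcA : #A = #B₀ + #(inside p q M W) :=
    card_union_of_disjoint (hBM.mono_right inside_subset)
  rw [hinA, hinX, hcA] at h1
  have h2 := card_erase_add_card_inside_le (u := u)
    (fun e he => hN e (hM.subset he)) hVW hWS (fun v hv hvu =>
      hcov v (mem_sdiff.1 hv).1 hvu (mem_sdiff.1 hv).2)
  have h3 := hM.two_mul_card_inside_le (S := S)
  have h4 := hP.card_inside (Q := Q) (filter_subset _ _)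
  have h5 := hM.sparse (Q.biUnion id) ⟨u, hSQ huS⟩
  have h6 : #(inside p q A (Q.biUnion id)) + #(inside p q M S) ≤
      #(inside p q (B₀ ∪ M) (Q.biUnion id)) := by
    rw [← card_union_of_disjoint]
    · exact card_le_card (union_subset (inside_mono hAB Subset.rfl)
        (inside_mono subset_union_right hSQ))
    · rw [disjoint_left]
      intro e he he'
      rw [mem_inside] at he he'
      rcases mem_union.1 he.1 with h | h
      · exact disjoint_left.1 hBM h he'.1
      · exact disjoint_left.1 hWS (mem_inside.1 h).2.1 he'.2.1
  rw [← hXdef] at h4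
  have h7 := card_erase_add_one huS
  have h8 := hM.sparse V ⟨u, hu⟩
  have hcB : #(B₀ ∪ M) = #B₀ + #M := card_union_of_disjoint hBM
  have hinB : inside p q (B₀ ∪ M) V = B₀ ∪ M := by
    refine filter_true_of_mem fun e he => ?_
    rcases mem_union.1 he with he | he
    exacts [hF e (hB₀F he), hN e (hM.subset he)]
  rw [hinB, hcB] at h8
  rw [hcB]
  by_contra hne
  have h9 : #B₀ + #M + m + 1 ≤ m * #V := by omega
  set x := #(links p q X (Q.biUnion id) (Q.biUnion id)) with hx
  have h10 : x + m + #(inside p q M S) ≤ m * #Q := by omega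
  have r1 : (#B₀ : ℝ) + #(inside p q M W) + m * #P = m * #V + #X := by exact_mod_cast h1
  have r2 : (#(inside p q M W) : ℝ) + #(S.erase u) ≤ #M + #(inside p q M S) := by
    exact_mod_cast h2
  have r3 : 2 * (#(inside p q M S) : ℝ) ≤ #(S.erase u) := by exact_mod_cast h3
  have r7 : (#(S.erase u) : ℝ) + 1 = #S := by exact_mod_cast h7
  have r9 : (#B₀ : ℝ) + #M + m + 1 ≤ m * #V := by exact_mod_cast h9
  have r10 : (x : ℝ) + m + #(inside p q M S) ≤ m * #Q := by exact_mod_cast h10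
  have hm' : (1 : ℝ) ≤ m := by exact_mod_cast hm
  -- With `s = |S| - 1`, this estimate, `r10` and `r3` make the left side of `hw` at least `(c - 1)
  -- (m + 1) + m + c s / 2`. The right side is `c (s + 1) / 2 + m (c - 1)`, which is smaller.
  have r11 : (1 : ℝ) ≤ m * #P - #X - m - #(S.erase u) + #(inside p q M S) := by linarith
  have r12 := mul_le_mul_of_nonneg_left r11 (show 0 ≤ c - 1 by linarith)
  have r13 := mul_le_mul_of_nonneg_left r3 (show 0 ≤ (c - 2) / 2 by linarith)
  rw [← r7] at hw
  linarith

end EdgeSparse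

/-! ### From tight sets to trees, and edges between classes -/

namespace EdgeSparse

open Finset

variable {α β : Type*} [DecidableEq α] [DecidableEq β]
variable {p q : β → α} {m : ℕ} {G H T : Graph α β} {B D : Finset β} {X Y V K : Finset α}

/-- The functions `p` and `q` pick the two ends of each edge of `G`. -/
def IsEnds (G : Graph α β) (p q : β → α) : Prop := ∀ e ∈ E(G), G.IsLink e (p e) (q e)

lemma exists_isEnds [Nonempty α] (G : Graph α β) : ∃ p q : β → α, IsEnds G p q := by
  have h : ∀ e, ∃ x y, e ∈ E(G) → G.IsLink e x y := fun e => by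
    by_cases he : e ∈ E(G)
    · obtain ⟨x, y, hxy⟩ := Graph.exists_isLink_of_mem_edgeSet he
      exact ⟨x, y, fun _ => hxy⟩
    · exact ⟨Classical.arbitrary α, Classical.arbitrary α, fun h => absurd h he⟩
  choose p q hpq using h
  exact ⟨p, q, hpq⟩

lemma IsEnds.mono (hG : IsEnds G p q) (hHG : H ≤ G) : IsEnds H p q := fun e he =>
  (hHG.isLink_iff he).2 (hG e (hHG.edgeSet_mono he))

lemma IsEnds.isLink_iff (hG : IsEnds G p q) {e : β} (he : e ∈ E(G)) {x y : α} :
    G.IsLink e x y ↔ (p e = x ∧ q e = y) ∨ (p e = y ∧ q e = x) :=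
  (hG e he).isLink_iff

lemma IsEnds.inc_iff (hG : IsEnds G p q) {e : β} (he : e ∈ E(G)) {x : α} :
    G.Inc e x ↔ Inc p q e x := by
  simp only [Graph.Inc, hG.isLink_iff he, Inc]
  constructor
  · rintro ⟨y, h | h⟩
    exacts [.inl h.1, .inr h.2]
  · rintro (h | h)
    exacts [⟨q e, .inl ⟨h, rfl⟩⟩, ⟨p e, .inr ⟨rfl, h⟩⟩]

/-- A `(1, 1)`-tight edge set is the edge set of a tree. -/
lemma isTree_of_tight [G.Loopless] (hG : IsEnds G p q) (hDG : ∀ e ∈ D, e ∈ E(G))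
    (hDX : ∀ e ∈ D, p e ∈ X ∧ q e ∈ X) (hD : Sparse p q 1 D) (hX : X.Nonempty)
    (hcard : #D + 1 = #X) : ((G.restrict (D : Set β)).induce (X : Set α)).IsTree := by
  have hlink : ∀ e x y, ((G.restrict (D : Set β)).induce (X : Set α)).IsLink e x y ↔
      (e ∈ D ∧ G.IsLink e x y) ∧ x ∈ X ∧ y ∈ X := by
    intro e x y
    simp
  have hDin : inside p q D X = D := filter_true_of_mem hDX
  have hXt : Tight p q 1 D X := ⟨hX, by rw [hDin, one_mul]; exact hcard⟩
  refine ⟨?_, ?_⟩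
  · refine { not_isLoopAt := fun e x h => ?_, eq_of_isLink := fun e f x y he hf => ?_ }
    · exact G.not_isLoopAt e x ((hlink e x x).1 h).1.2
    · rw [hlink] at he hf
      by_contra hne
      have hin : ∀ g, g ∈ D ∧ G.IsLink g x y → g ∈ inside p q D {x, y} := by
        intro g hg
        have := (hG.isLink_iff (hDG g hg.1)).1 hg.2
        rw [mem_inside]
        refine ⟨hg.1, ?_⟩
        rcases this with ⟨rfl, rfl⟩ | ⟨rfl, rfl⟩ <;> simp
      have h1 : ({e, f} : Finset β) ⊆ inside p q D {x, y} := by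
        rw [insert_subset_iff, singleton_subset_iff]
        exact ⟨hin e he.1, hin f hf.1⟩
      have h2 := card_le_card h1
      rw [card_pair hne] at h2
      have h3 := hD {x, y} ⟨x, by simp⟩
      have h4 : #({x, y} : Finset α) ≤ 2 := card_le_two
      omega
  · set T := (G.restrict (D : Set β)).induce (X : Set α) with hT
    have hVT : V(T) = (X : Set α) := rfl
    have : Finite V(T) := by rw [hVT]; exact X.finite_toSet
    have hadj : ∀ e ∈ D, ∀ x y : V(T), (p e = x ∧ q e = y) ∨ (p e = y ∧ q e = x) →
        T.toSimpleGraph.Adj x y := by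
      intro e he x y h
      have hGl : G.IsLink e x y := (hG.isLink_iff (hDG e he)).2 h
      exact ⟨fun hxy => hGl.ne (by rw [hxy]), e, (hlink e x y).2 ⟨⟨he, hGl⟩, x.2, y.2⟩⟩
    have hconn : T.toSimpleGraph.Connected := by
      obtain ⟨x₀, hx₀⟩ := hX
      have : Nonempty V(T) := ⟨⟨x₀, hx₀⟩⟩
      refine ⟨fun x y => ?_⟩
      classical
      set R : Finset α := X.filter fun z => ∃ hz : z ∈ X, T.toSimpleGraph.Reachable x ⟨z, hz⟩
        with hR
      by_cases hXR : X ⊆ R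
      · obtain ⟨_, _, h⟩ := mem_filter.1 (hXR y.2)
        exact h
      · obtain ⟨e, he, h⟩ := hXt.exists_crossing le_rfl hD (X := R)
          ⟨x, mem_inter.2 ⟨x.2, mem_filter.2 ⟨x.2, x.2, .refl x⟩⟩⟩ hXR
        have heD := (mem_inside.1 he).1
        have hp := (hDX e heD).1
        have hq := (hDX e heD).2
        exfalso
        rcases h with ⟨h1, h2⟩ | ⟨h1, h2⟩
        · obtain ⟨_, _, h3⟩ := mem_filter.1 h1
          exact h2 (mem_filter.2 ⟨hq, hq, h3.trans
            (hadj e heD ⟨p e, hp⟩ ⟨q e, hq⟩ (.inl ⟨rfl, rfl⟩)).reachable⟩)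
        · obtain ⟨_, _, h3⟩ := mem_filter.1 h2
          exact h1 (mem_filter.2 ⟨hp, hp, h3.trans
            (hadj e heD ⟨q e, hq⟩ ⟨p e, hp⟩ (.inr ⟨rfl, rfl⟩)).reachable⟩)
    rw [SimpleGraph.isTree_iff_connected_and_card]
    refine ⟨hconn, le_antisymm ?_ hconn.card_vert_le_card_edgeSet_add_one⟩
    have hVcard : Nat.card V(T) = #X := by
      rw [hVT]; simp
    rw [hVcard, ← hcard]
    refine Nat.add_le_add_right ?_ 1
    have hf : ∀ s : T.toSimpleGraph.edgeSet, ∃ e : D, s.1.map Subtype.val = s(p e.1, q e.1) := by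
      rintro ⟨s, hs⟩
      induction s using Sym2.ind with
      | _ x y =>
        rw [SimpleGraph.mem_edgeSet] at hs
        obtain ⟨-, e, he⟩ := hs
        rw [hlink] at he
        refine ⟨⟨e, he.1.1⟩, ?_⟩
        rw [Sym2.map_mk, Sym2.eq_iff]
        have := (hG.isLink_iff (hDG e he.1.1)).1 he.1.2
        tauto
    choose f hf using hf
    have hinj : Function.Injective f := by
      intro s s' h
      apply Subtype.ext
      apply Sym2.map.injective Subtype.val_injective
      rw [hf, hf, h]
    have := Nat.card_le_card_of_injective f hinj
    simpa using this

/-- A tight set of an `(m, m)`-sparse edge set of `G` induces an `m`-tree-connected subgraph. -/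
lemma Tight.isTreeConnected [G.Loopless] (hm : 1 ≤ m) (hG : IsEnds G p q)
    (hBG : ∀ e ∈ B, e ∈ E(G)) (hB : Sparse p q m B) (hX : Tight p q m B X) :
    (G.induce (X : Set α)).IsTreeConnected m := by
  obtain ⟨T, hT, hdj, hsum⟩ := (hB.mono (inside_subset (X := X))).exists_forests hm
  have hTX : ∀ i, ∀ e ∈ T i, p e ∈ X ∧ q e ∈ X := fun i e he =>
    (mem_inside.1 ((hT i).1 he)).2
  have hle : ∀ i, #(T i) + 1 ≤ #X := by
    intro i
    have h := (hT i).2 X hX.1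
    rwa [show inside p q (T i) X = T i from filter_true_of_mem (hTX i), one_mul] at h
  -- The `m` forests have at most `|X| - 1` edges each and `m (|X| - 1)` in total, so each of them
  -- is a spanning tree of `X`.
  have heq : ∀ i, #(T i) + 1 = #X := by
    have h1 : ∑ i, (#(T i) + 1) = ∑ _i : Fin m, #X := by
      rw [sum_add_distrib, hsum]
      simpa using hX.2
    intro i
    exact (sum_eq_sum_iff_of_le fun i _ => hle i).1 h1 i (mem_univ i)
  have hTG : ∀ i, ∀ e ∈ T i, e ∈ E(G) := fun i e he => hBG e (inside_subset ((hT i).1 he))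
  refine ⟨fun i => (G.restrict (T i : Set β)).induce (X : Set α), fun i => ⟨⟨⟨?_, ?_⟩, rfl⟩,
    isTree_of_tight hG (hTG i) (hTX i) (hT i).2 hX.1 (heq i)⟩, fun i j hij => ?_⟩
  · exact Subset.rfl
  · intro e x y h
    simp only [Graph.induce_isLink, Graph.restrict_isLink] at h ⊢
    exact ⟨h.1.2, h.2⟩
  · refine Set.disjoint_left.2 ?_
    rintro e ⟨x, y, h⟩ ⟨x', y', h'⟩
    simp only [Graph.restrict_isLink] at h h'
    exact disjoint_left.1 (hdj hij) h.1.1 h'.1.1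

/-- A connected spanning graph on `Y` has many edges between the classes of any labelling. -/
lemma card_image_le_of_connected {ι : Type*} [DecidableEq ι] (hT : T.toSimpleGraph.Connected)
    (hVT : V(T) = (Y : Set α)) (hends : IsEnds T p q) (r : α → ι)
    (hD : ∀ e, e ∈ D ↔ e ∈ E(T) ∧ r (p e) ≠ r (q e)) : #(Y.image r) ≤ #D + 1 := by
  classical
  let f : V(T) → {a // a ∈ Y.image r} := fun v =>
    ⟨r v, mem_image_of_mem r (mem_coe.1 (hVT.subset v.2))⟩
  -- The quotient on the labels is connected, and each of its edges comes from a different edge of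
  -- `D`.
  let Γ : SimpleGraph {a // a ∈ Y.image r} := SimpleGraph.fromRel fun a b =>
    ∃ e ∈ D, r (p e) = a ∧ r (q e) = b
  have hstep : ∀ x y : V(T), T.toSimpleGraph.Adj x y →
      Relation.ReflTransGen Γ.Adj (f x) (f y) := by
    rintro x y ⟨-, e, he⟩
    by_cases hxy : r x = r y
    · rw [show f x = f y from Subtype.ext hxy]
    · refine .single ((SimpleGraph.fromRel_adj _ _ _).2
        ⟨fun h => hxy (congrArg Subtype.val h), ?_⟩)
      have heT := he.edge_mem
      rcases (hends.isLink_iff heT).1 he with h | h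
      · exact .inl ⟨e, (hD e).2 ⟨heT, by rwa [h.1, h.2]⟩, by rw [h.1], by rw [h.2]⟩
      · exact .inr ⟨e, (hD e).2 ⟨heT, by rw [h.1, h.2]; exact Ne.symm hxy⟩,
          by rw [h.1], by rw [h.2]⟩
  have hsurj : Function.Surjective f := by
    rintro ⟨a, ha⟩
    obtain ⟨v, hv, rfl⟩ := mem_image.1 ha
    exact ⟨⟨v, by rw [hVT]; exact hv⟩, rfl⟩
  have hconn : Γ.Connected := by
    have := hT.nonempty
    have : Nonempty {a // a ∈ Y.image r} := ⟨f (Classical.arbitrary _)⟩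
    refine ⟨fun a b => ?_⟩
    obtain ⟨x, rfl⟩ := hsurj a
    obtain ⟨y, rfl⟩ := hsurj b
    rw [SimpleGraph.reachable_iff_reflTransGen]
    exact Relation.ReflTransGen.lift' (f := f) hstep _ _
      ((SimpleGraph.reachable_iff_reflTransGen _ _).1 (hT.preconnected x y))
  have h1 := hconn.card_vert_le_card_edgeSet_add_one
  rw [Nat.card_eq_fintype_card, Fintype.card_coe] at h1
  refine h1.trans (Nat.add_le_add_right ?_ 1)
  have hg : ∀ s : Γ.edgeSet, ∃ e : D, s.1.map Subtype.val = s(r (p e.1), r (q e.1)) := by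
    rintro ⟨s, hs⟩
    induction s using Sym2.ind with
    | _ a b =>
      rw [SimpleGraph.mem_edgeSet, SimpleGraph.fromRel_adj] at hs
      rcases hs.2 with ⟨e, he, h⟩ | ⟨e, he, h⟩
      · exact ⟨⟨e, he⟩, by rw [Sym2.map_mk, h.1, h.2]⟩
      · exact ⟨⟨e, he⟩, by rw [Sym2.map_mk, h.1, h.2, Sym2.eq_swap]⟩
  choose g hg using hg
  have hinj : Function.Injective g := by
    intro s s' h
    apply Subtype.ext
    apply Sym2.map.injective Subtype.val_injective
    rw [hg, hg, h]
  simpa using Nat.card_le_card_of_injective g hinj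

end EdgeSparse

/-! ### Tree components, boundaries and components in terms of edge sets -/

namespace EdgeSparse

open Finset

variable {α β : Type*} [DecidableEq α] [DecidableEq β]
variable {p q : β → α} {m : ℕ} {F G H : Graph α β} {B D E : Finset β} {X Y V K : Finset α}

/-- The maximal tight sets of a maximal sparse set of edges are the tree components. -/
lemma isTreeComponent_of_maximal [F.Loopless] (hm : 1 ≤ m) (hF : IsEnds F p q)
    (hVF : V(F) = (V : Set α)) (hBF : ∀ e ∈ B, e ∈ E(F)) (hB : Sparse p q m B)
    (hspan : ∀ e ∈ E(F), e ∉ B → ∃ X, Tight p q m B X ∧ p e ∈ X ∧ q e ∈ X)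
    (hX : Maximal (fun T => Tight p q m B T ∧ T ⊆ V) X) : F.IsTreeComponent m (X : Set α) := by
  classical
  have hFV : ∀ e ∈ E(F), p e ∈ V ∧ q e ∈ V := fun e he => by
    rw [← mem_coe, ← mem_coe, ← hVF]
    exact ⟨(hF e he).left_mem, (hF e he).right_mem⟩
  have hBV : ∀ e ∈ B, p e ∈ V ∧ q e ∈ V := fun e he => hFV e (hBF e he)
  refine ⟨⟨by rw [hVF]; exact_mod_cast hX.prop.2, hX.prop.1.isTreeConnected hm hF hBF hB⟩, ?_⟩
  rintro Y' ⟨hYV', T, hT, hdT⟩ hXY'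
  rw [hVF] at hYV'
  obtain ⟨Y, rfl⟩ : ∃ Y : Finset α, Y' = (Y : Set α) :=
    ⟨(V.finite_toSet.subset hYV').toFinset, by simp⟩
  have hYV : Y ⊆ V := by exact_mod_cast hYV'
  have hXY : X ⊆ Y := by exact_mod_cast hXY'
  obtain ⟨P, hP⟩ := exists_isTightPartition hB V
  obtain ⟨C₀, hC₀, hXC₀⟩ := hP.exists_superset X hX.prop.1 hX.prop.2
  have hXeq : X = C₀ := hX.eq_of_le ⟨hP.tight _ hC₀, hP.subset hC₀⟩ hXC₀
  have hr : ∀ v, ∃ C, v ∈ V → C ∈ P ∧ v ∈ C := fun v => by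
    by_cases hv : v ∈ V
    · obtain ⟨C, hC⟩ := hP.exists_mem hv
      exact ⟨C, fun _ => hC⟩
    · exact ⟨∅, fun h => absurd h hv⟩
  choose r hr using hr
  set Q := Y.image r with hQ
  have hQP : Q ⊆ P := fun C hC => by
    obtain ⟨v, hv, rfl⟩ := mem_image.1 hC
    exact (hr v (hYV hv)).1
  have hYQ : Y ⊆ Q.biUnion id := fun v hv =>
    mem_biUnion.2 ⟨r v, mem_image_of_mem r hv, (hr v (hYV hv)).2⟩
  set U := Q.biUnion id with hU
  set L := links p q (crossing p q P B) U U with hL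
  have hTends : ∀ i, IsEnds (T i) p q := fun i e he => by
    have h1 := (hT i).1.le.edgeSet_mono he
    obtain ⟨x, y, h⟩ := Graph.exists_isLink_of_mem_edgeSet h1
    have h2 := h
    rw [Graph.induce_isLink] at h2
    rw [(hT i).1.le.isLink_iff he, Graph.induce_isLink]
    have h3 := hF e h2.1.edge_mem
    refine ⟨h3, ?_⟩
    rcases (hF.isLink_iff h2.1.edge_mem).1 h2.1 with ⟨rfl, rfl⟩ | ⟨rfl, rfl⟩
    exacts [h2.2, h2.2.symm]
  have hTV : ∀ i, V(T i) = (Y : Set α) := fun i => (hT i).1.vertexSet_eq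
  have hTF : ∀ i, ∀ e ∈ E(T i), e ∈ E(F) := fun i e he => by
    obtain ⟨x, y, h, -⟩ := (hT i).1.le.edgeSet_mono he
    exact h.edge_mem
  have hTL : ∀ i, ∀ e ∈ E(T i), r (p e) ≠ r (q e) → e ∈ L := by
    intro i e he hne
    have heF := hTF i e he
    have hcr : ∀ C ∈ P, ¬ (p e ∈ C ∧ q e ∈ C) := fun C hC h => hne
      ((hP.eq_of_mem (hr _ (hFV e heF).1).1 hC (hr _ (hFV e heF).1).2 h.1).trans
        (hP.eq_of_mem (hr _ (hFV e heF).2).1 hC (hr _ (hFV e heF).2).2 h.2).symm)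
    have h1 := (hTends i e he).left_mem
    have h2 := (hTends i e he).right_mem
    rw [hTV, mem_coe] at h1 h2
    refine mem_links.2 ⟨mem_crossing.2 ⟨?_, hcr⟩, hYQ h1, hYQ h2⟩
    by_contra heB
    obtain ⟨Z, hZ, hpZ, hqZ⟩ := hspan e heF heB
    obtain ⟨C, hC, hZC⟩ := hP.exists_superset Z hZ
      (hZ.subset_of_mem hm hB hBV hpZ (hFV e heF).1)
    exact hcr C hC ⟨hZC hpZ, hZC hqZ⟩
  set D : Fin m → Finset β := fun i => L.filter fun e => e ∈ E(T i) ∧ r (p e) ≠ r (q e) with hD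
  have hDcard : ∀ i, #Q ≤ #(D i) + 1 := fun i =>
    card_image_le_of_connected (hT i).2.2.connected (hTV i) (hTends i) r fun e => by
      rw [hD, mem_filter]
      exact ⟨fun h => h.2, fun h => ⟨hTL i e h.1 h.2, h⟩⟩
  have hDL : ∑ i, #(D i) ≤ #L := by
    rw [← card_biUnion]
    · exact card_le_card (biUnion_subset.2 fun i _ => filter_subset _ _)
    · intro i _ j _ hij
      refine disjoint_left.2 fun e h1 h2 => ?_
      exact Set.disjoint_left.1 (hdT hij) (mem_filter.1 h1).2.1 (mem_filter.1 h2).2.1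
  -- Each of the `m` disjoint trees on `Y` needs `|Q| - 1` edges between the classes, and all these
  -- edges are crossing edges of `B`. This makes the union `U` of the classes tight, so `U` is a
  -- single class.
  have hmL : m * #Q ≤ #L + m := by
    have h1 := sum_le_sum fun i (_ : i ∈ univ) => hDcard i
    rw [sum_add_distrib] at h1
    simp only [sum_const, card_univ, Fintype.card_fin, smul_eq_mul, mul_one] at h1
    omega
  have hcard := hP.card_inside hQP
  rw [← hU, ← hL] at hcard
  obtain ⟨x, hx⟩ := hX.prop.1.1
  have hUne : U.Nonempty := ⟨x, hYQ (hXY hx)⟩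
  have hBU := hB U hUne
  have hUt : Tight p q m B U := ⟨hUne, by omega⟩
  obtain ⟨C, hC, hUC⟩ := hP.exists_superset U hUt
    (biUnion_subset.2 fun C hC => hP.subset (hQP hC))
  have hCX : C = X := by
    rw [hXeq]
    exact hP.eq_of_mem hC hC₀ (hUC (hYQ (hXY hx))) (hXeq ▸ hx)
  exact_mod_cast (hYQ.trans hUC).trans hCX.subset

lemma boundaryDegree_eq (hF : IsEnds F p q) {E : Finset β} (hE : ∀ e, e ∈ E ↔ e ∈ E(F))
    (X : Finset α) : F.boundaryDegree (X : Set α) = boundary p q E X := by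
  rw [Graph.boundaryDegree, boundary, ← Set.ncard_coe_finset]
  congr 1
  ext e
  simp only [Set.mem_ofPred_eq, mem_coe, coe_filter]
  constructor
  · rintro ⟨x, hx, y, hy, h⟩
    refine ⟨(hE e).2 h.edge_mem, ?_⟩
    rcases (hF.isLink_iff h.edge_mem).1 h with ⟨rfl, rfl⟩ | ⟨rfl, rfl⟩
    exacts [.inl ⟨hx, hy⟩, .inr ⟨hy, hx⟩]
  · rintro ⟨he, h | h⟩
    · exact ⟨p e, h.1, q e, h.2, hF e ((hE e).1 he)⟩
    · exact ⟨q e, h.2, p e, h.1, (hF e ((hE e).1 he)).symm⟩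

/-- A labelling that is constant along the edges takes at most one value per component. -/
lemma card_image_le_numComponents {ι : Type*} [DecidableEq ι] (hG : IsEnds G p q)
    (hVG : V(G) = (V : Set α)) (hKV : K ⊆ V) (r : α → ι)
    (hr : ∀ e ∈ E(G), p e ∈ K → q e ∈ K → r (p e) = r (q e)) :
    #(K.image r) ≤ (G.deleteVerts ((V \ K : Finset α) : Set α)).numComponents := by
  set G' := G.deleteVerts ((V \ K : Finset α) : Set α) with hG'
  have hV' : V(G') = (K : Set α) := by
    rw [hG', Graph.vertexSet_deleteVerts, hVG, ← coe_sdiff, Finset.sdiff_sdiff_eq_self hKV]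
  have : Finite V(G') := by rw [hV']; exact K.finite_toSet
  have hadj : ∀ x y : V(G'), G'.toSimpleGraph.Adj x y → r x = r y := by
    rintro x y ⟨-, e, he⟩
    have he := ((G.deleteVerts_isLink _).1 he)
    have hx : (x : α) ∈ K := mem_coe.1 (hV'.subset x.2)
    have hy : (y : α) ∈ K := mem_coe.1 (hV'.subset y.2)
    have h := hr e he.1.edge_mem
    rcases (hG.isLink_iff he.1.edge_mem).1 he.1 with ⟨h1, h2⟩ | ⟨h1, h2⟩
    · rw [h1, h2] at h; exact h hx hy
    · rw [h1, h2] at h; exact (h hy hx).symm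
  have hreach : ∀ x y : V(G'), G'.toSimpleGraph.Reachable x y → r x = r y := by
    rintro x y ⟨w⟩
    induction w with
    | nil => rfl
    | cons h _ ih => exact (hadj _ _ h).trans ih
  let f : G'.toSimpleGraph.ConnectedComponent → ι :=
    Quot.lift (fun x : V(G') => r x) hreach
  have hsub : ((K.image r : Finset ι) : Set ι) ⊆ Set.range f := by
    intro a ha
    obtain ⟨v, hv, rfl⟩ := mem_image.1 (mem_coe.1 ha)
    exact ⟨Quot.mk _ ⟨v, hV'.superset hv⟩, rfl⟩
  have : Finite G'.toSimpleGraph.ConnectedComponent := Quot.finite _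
  rw [Graph.numComponents, ← Set.ncard_coe_finset]
  refine (Set.ncard_le_ncard hsub (Set.finite_range f)).trans ?_
  rw [← Set.image_univ, ← Set.ncard_univ]
  exact Set.ncard_image_le Set.finite_univ

end EdgeSparse

/-! ### Proof of the main theorem -/

open EdgeSparse in
theorem mainTheorem11 {α β : Type*} (G F : Graph α β) [G.Loopless]
    (hVfin : V(G).Finite) (hEfin : E(G).Finite)
    (m : ℕ) (hm : 1 ≤ m) (c : ℝ) (hc : 2 * (m : ℝ) + 1 ≤ c)
    (hF : F ≤s G)
    (hcomp : ∀ X : Set α, F.IsTreeComponent m X →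
      c - (c - 1) / (2 * (m : ℝ)) * (F.boundaryDegree X : ℝ) ≤ (X.ncard : ℝ))
    (htough : ∀ S : Set α, S ⊆ V(G) →
      ((G.deleteVerts S).numComponents : ℝ) ≤
        (c - 2 * (m : ℝ)) / (2 * (m : ℝ) * (c - 1)) * (S.ncard : ℝ) + 1)
    (u : α) (hu : u ∈ V(G)) :
    ∃ H : Graph α β, F ≤s H ∧ H ≤s G ∧ H.IsTreeConnected m ∧
      (∀ v ∈ V(G), H.degree v ≤ F.degree v + 1) ∧ H.degree u = F.degree u := by
  classical
  have : Nonempty α := ⟨u⟩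
  obtain ⟨p, q, hpq⟩ := exists_isEnds G
  obtain ⟨V, hV⟩ : ∃ V : Finset α, V(G) = (V : Set α) := ⟨hVfin.toFinset, by simp⟩
  obtain ⟨E, hE⟩ : ∃ E : Finset β, E(G) = (E : Set β) := ⟨hEfin.toFinset, by simp⟩
  have hpqF := hpq.mono hF.le
  have hFloop : F.Loopless := Graph.Loopless.anti hF.le
  set EF := E.filter (· ∈ E(F)) with hEF
  have hmemF : ∀ e, e ∈ EF ↔ e ∈ E(F) := fun e => by
    rw [hEF, Finset.mem_filter, and_iff_right_iff_imp, ← Finset.mem_coe, ← hE]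
    exact fun h => hF.le.edgeSet_mono h
  set N := E \ EF with hN
  have hEFE : EF ⊆ E := Finset.filter_subset _ _
  have hEV : ∀ e ∈ E, p e ∈ V ∧ q e ∈ V := fun e he => by
    rw [← Finset.mem_coe, ← hE] at he
    rw [← Finset.mem_coe, ← Finset.mem_coe, ← hV]
    exact ⟨(hpq e he).left_mem, (hpq e he).right_mem⟩
  -- By maximality, every edge of `F` outside `B` is spanned by a tight set, so `B` determines the
  -- tree components of `F`.
  obtain ⟨B, hBmem, hBmax⟩ := Finset.exists_max_image
    (EF.powerset.filter fun B => Sparse p q m B) (fun B => B.card)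
    ⟨∅, Finset.mem_filter.2 ⟨by simp, sparse_empty⟩⟩
  obtain ⟨hBF, hB⟩ := Finset.mem_filter.1 hBmem
  rw [Finset.mem_powerset] at hBF
  have hspan : ∀ e ∈ EF, e ∉ B → ∃ X, Tight p q m B X ∧ p e ∈ X ∧ q e ∈ X := by
    intro e he heB
    obtain ⟨T, hT⟩ := exists_isSpan (e := e) hB fun hs => by
      have := hBmax (insert e B) (Finset.mem_filter.2
        ⟨Finset.mem_powerset.2 (Finset.insert_subset he hBF), hs⟩)
      rw [Finset.card_insert_of_notMem heB] at this
      omega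
    exact ⟨T, hT.1, hT.2.1, hT.2.2.1⟩
  obtain ⟨M, hM, hcard⟩ := exists_matching_basis (N := N) hm hc
    (fun e he => hEV e (hEFE he)) (fun e he => hEV e (Finset.sdiff_subset he))
    Finset.disjoint_sdiff hB hBF hspan
    (fun X hX => by
      have h := hcomp X (isTreeComponent_of_maximal hm hpqF (hF.vertexSet_eq.trans hV)
        (fun e he => (hmemF e).1 (hBF he)) hB (fun e he => hspan e ((hmemF e).2 he)) hX)
      rwa [boundaryDegree_eq hpqF hmemF, Set.ncard_coe_finset] at h)
    (fun K hK r hr => by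
      have h := htough ((V \ K : Finset α) : Set α) (by
        rw [hV]; exact_mod_cast Finset.sdiff_subset)
      rw [Set.ncard_coe_finset] at h
      refine le_trans ?_ h
      refine Nat.cast_le.2 (card_image_le_numComponents hpq hV hK r fun e he => hr e ?_)
      rw [hN, Finset.union_sdiff_of_subset hEFE, ← Finset.mem_coe, ← hE]
      exact he)
    (u := u) (by rw [hV] at hu; exact hu)
  set H := G.restrict (E(F) ∪ (M : Set β)) with hH
  have hMG : ∀ e ∈ M, e ∈ E(G) := fun e he => by
    rw [hE]; exact Finset.sdiff_subset (hM.subset he)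
  have hHG : H ≤s G := ⟨Graph.restrict_le, rfl⟩
  have hFH : F ≤s H := ⟨⟨hF.vertexSet_eq.subset, fun e x y h =>
    ⟨.inl h.edge_mem, h.mono hF.le⟩⟩, hF.vertexSet_eq⟩
  have hHloop : H.Loopless := Graph.Loopless.anti hHG.le
  have hinc : ∀ v, H.incidenceSet v = F.incidenceSet v ∪ {e | e ∈ M ∧ Inc p q e v} := by
    intro v
    ext e
    simp only [Graph.mem_incidenceSet, hH, Graph.restrict_inc, Set.mem_union, Set.mem_ofPred_eq,
      Finset.mem_coe]
    constructor
    · rintro ⟨h, he | he⟩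
      · exact .inl ((hF.le.inc_congr he).2 h)
      · exact .inr ⟨he, (hpq.inc_iff (hMG e he)).1 h⟩
    · rintro (h | ⟨he, h⟩)
      · exact ⟨h.mono hF.le, .inl h.edge_mem⟩
      · exact ⟨(hpq.inc_iff (hMG e he)).2 h, .inr he⟩
  refine ⟨H, hFH, hHG, ?_, fun v _ => ?_, ?_⟩
  · have hVB : Tight p q m (B ∪ M) V := by
      refine ⟨⟨u, by rw [hV] at hu; exact hu⟩, ?_⟩
      rw [show inside p q (B ∪ M) V = B ∪ M from Finset.filter_true_of_mem fun e he => ?_, hcard]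
      rcases Finset.mem_union.1 he with he | he
      · exact hEV e (hEFE (hBF he))
      · exact hEV e (Finset.sdiff_subset (hM.subset he))
    have h := hVB.isTreeConnected hm (hpq.mono hHG.le) (fun e he => by
      rw [hH, Graph.edgeSet_restrict]
      rcases Finset.mem_union.1 he with he | he
      · have := (hmemF e).1 (hBF he)
        exact ⟨hF.le.edgeSet_mono this, .inl this⟩
      · exact ⟨hMG e he, .inr he⟩) hM.sparse
    rwa [← hV, ← hHG.vertexSet_eq, Graph.induce_vertexSet] at h
  · rw [Graph.degree, Graph.degree, hinc]
    refine (Set.ncard_union_le _ _).trans (Nat.add_le_add_left ?_ _)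
    refine (Set.ncard_le_one (M.finite_toSet.subset fun e he => he.1)).2
      fun e he f hf => hM.eq_of_inc e he.1 f hf.1 v he.2 hf.2
  · rw [Graph.degree, Graph.degree, hinc]
    rw [show {e | e ∈ M ∧ Inc p q e u} = ∅ from
      Set.eq_empty_of_forall_notMem fun e he => hM.not_inc e he.1 he.2, Set.union_empty]
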